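/- Let $X$ be a metric space, $\mu$ a Borel measure on $X$ and $n>0$ a real number such that $(X,\mu)$ is $n$-regular, that is, there are constants $0<c\le C<\infty$ with $$c\,(r\wedge \operatorname{diam} X)^n\le \mu(B(x,r))\le C\,(r\wedge \operatorname{diam} X)^n\qquad (x\in X,\ r>0),$$ where $\operatorname{diam}X\in[0,\infty]$. Let $V$ be a finite-dimensional complex inner product space (for example $V=\mathbb{C}$ or $V=\mathbb{C}^m$) and write $L^p=L^p(X,\mu;V)$. Let $1\le s<2<q<\infty$ and $p\in(s,q)$, let $U\subseteq\mathbb{C}\setminus\{0\}$, and let $\{T(z)\}_{z\in U}$ be a family of bounded linear operators on $L^2$ that satisfies $L^s\to L^q$ off-diagonal estimates of order $\gamma>n/s$: there is a constant $C<\infty$ such that for all $z\in U$, all $f\in L^s\cap L^2$ and all Borel sets $E,F\subseteq X$, $$\|\mathbf 1_F\,T(z)\,\mathbf 1_E f\|_q\le C\,(|z|\wedge\operatorname{diam}X)^{\frac nq-\frac ns}\Bigl(1+\frac{\operatorname{dist}(E,F)}{|z|}\Bigr)^{-\gamma}\|\mathbf 1_E f\|_s .$$ Then $\{T(z)\}_{z\in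 U}$ satisfies square function estimates on $L^p$: there is a constant $C<\infty$ such that for all $k\in\mathbb{N}$, all $z_1,\dots,z_k\in U$ and all $f_1,\dots,f_k\in L^p\cap L^2$, $$\Bigl\|\Bigl(\sum_{j=1}^k|T(z_j)f_j|^2\Bigr)^{1/2}\Bigr\|_p\le C\,\Bigl\|\Bigl(\sum_{j=1}^k|f_j|^2\Bigr)^{1/2}\Bigr\|_p .$$ Moreover, each $T(z)$ extends from $L^p\cap L^2$ to a bounded linear operator $S(z)$ on $L^p$, the family $\{S(z)\}_{z\in U}$ is uniformly bounded, and it is $R$-bounded on $L^p$: there is a constant $C<\infty$ such that for all $k\in\mathbb{N}$, $z_1,\dots,z_k\in U$ and $f_1,\dots,f_k\in L^p$, $$\mathbb{E}\Bigl\|\sum_{j=1}^k\varepsilon_j S(z_j)f_j\Bigr\|_p\le C\,\mathbb{E}\Bigl\|\sum_{j=1}^k\varepsilon_j f_j\Bigr\|_p ,$$ where $\varepsilon_1,\dots,\varepsilon_k$ are independent random signs, each equal to $\pm1$ with probability $\tfrac12$. -/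

import Mathlib

open MeasureTheory
open scoped ENNReal NNReal

/-- `n`-regularity of a metric space with a Borel measure: `μ (B(x, r)) ≈ (r ∧ diam X) ^ n`
for all `x` and all `r > 0`, with constants that depend on neither `x` nor `r`.
The diameter is taken in `[0, ∞]`. -/
def IsRegularSpace {X : Type*} [MetricSpace X] [MeasurableSpace X]
    (μ : Measure X) (n : ℝ) : Prop :=
  ∃ c C : ℝ≥0, 0 < c ∧ ∀ (x : X) (r : ℝ), 0 < r →
    (c : ℝ≥0∞) * min (ENNReal.ofReal r) (Metric.ediam (Set.univ : Set X)) ^ n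
        ≤ μ (Metric.ball x r) ∧
    μ (Metric.ball x r)
        ≤ (C : ℝ≥0∞) * min (ENNReal.ofReal r) (Metric.ediam (Set.univ : Set X)) ^ n

/-- The distance `dist(E, F) = inf {d(x, y) : x ∈ E, y ∈ F}` of two sets, with values in
`[0, ∞]` (it is `∞` if one of the sets is empty). -/
noncomputable def setEDist {X : Type*} [MetricSpace X] (E F : Set X) : ℝ≥0∞ :=
  ⨅ x ∈ E, ⨅ y ∈ F, edist x y

/-- `L^p → L^q` off-diagonal estimates of order `γ`, relative to the dimension `n`, for a family
`{T(z)}_{z ∈ U}` of operators on `L²(X; V)`: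
`‖1_F T(z) 1_E f‖_q ≤ C (|z| ∧ diam X)^(n/q - n/p) (1 + dist(E, F)/|z|)^(-γ) ‖1_E f‖_p`.
For an infinite exponent `q` one has `q.toReal = 0`, hence `n / q.toReal = 0`, as it should be. -/
def OffDiagonalEstimates {X : Type*} [MetricSpace X] [MeasurableSpace X] (μ : Measure X)
    {V : Type*} [NormedAddCommGroup V] (n : ℝ) {U : Set ℂ}
    (T : U → Lp V 2 μ → Lp V 2 μ) (p q : ℝ≥0∞) (γ : ℝ) : Prop :=
  ∃ C : ℝ≥0, ∀ (z : U) (f : X → V) (hf : MemLp f 2 μ), MemLp f p μ →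
    ∀ (E F : Set X) (hE : MeasurableSet E), MeasurableSet F →
      eLpNorm (F.indicator (T z ((hf.indicator hE).toLp (E.indicator f)))) q μ
        ≤ (C : ℝ≥0∞)
          * min (ENNReal.ofReal ‖(z : ℂ)‖) (Metric.ediam (Set.univ : Set X))
              ^ (n / q.toReal - n / p.toReal)
          * (1 + setEDist E F / ENNReal.ofReal ‖(z : ℂ)‖) ^ (-γ)
          * eLpNorm (E.indicator f) p μ

/-- Square function estimates on `L^p` for a family of operators on `L²(X; V)`. The constant is
uniform in the number of operators, the indices and the functions. -/
def SquareFunctionEstimates {X : Type*} [MeasurableSpace X] (μ : Measure X)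
    {V : Type*} [NormedAddCommGroup V] {ι : Type*}
    (T : ι → Lp V 2 μ → Lp V 2 μ) (p : ℝ≥0∞) : Prop :=
  ∃ C : ℝ≥0, ∀ (k : ℕ) (z : Fin k → ι) (f : Fin k → Lp V 2 μ), (∀ j, MemLp (f j) p μ) →
    eLpNorm (fun x => √(∑ j, ‖T (z j) (f j) x‖ ^ 2)) p μ
      ≤ (C : ℝ≥0∞) * eLpNorm (fun x => √(∑ j, ‖f j x‖ ^ 2)) p μ

/-- The Rademacher average `𝔼 ‖∑ j, ε_j x_j‖` over independent uniformly distributed signs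
`ε_j ∈ {1, -1}`. -/
noncomputable def rademacherAverage {B : Type*} [NormedAddCommGroup B] {k : ℕ}
    (x : Fin k → B) : ℝ :=
  (2 ^ k : ℝ)⁻¹ * ∑ ε : Fin k → ℤˣ, ‖∑ j, ε j • x j‖

/-- `R`-boundedness of a family of bounded linear operators on a Banach space. -/
def IsRBounded {B : Type*} [NormedAddCommGroup B] [NormedSpace ℂ B] {ι : Type*}
    (S : ι → B →L[ℂ] B) : Prop :=
  ∃ C : ℝ, ∀ (k : ℕ) (z : Fin k → ι) (x : Fin k → B),
    rademacherAverage (fun j => S (z j) (x j)) ≤ C * rademacherAverage x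

/-!
Write `v(r) = (r ∧ diam X) ^ n`, `A_r g(x) = v(r)⁻¹ ∫_{B(x, r)} g` and `t = |z|`.

*Local estimate.* Splitting `f` along the dyadic annuli around `B(x, t)`, off-diagonal estimates of
order `γ` give
`(A_t |T(z)f|^q)^{1/q}(x) ≲ ∑ₖ 2^{-kδ} (A_{2^{k+1}t} |f|^s)^{1/s}(x)` with `δ = γ - n/s > 0`
(`exists_ballAvg_le_tsum_ballAvg`).

*Weighted estimate.* Since `∫ |T(z)f|² w ≲ ∫ A_t(|T(z)f|² w)`, Hölder's inequality with exponent
`q/2` and its conjugate `r` reduces the bound `∫ |T(z)f|² w ≲ ∫ |f|² w`, uniform in `z`, to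
`∫ (A_R g^s)^{2/s} (A_t w^r)^{1/r} ≲ ∫ g² w` for `t ≤ R`; weights with this property are called
admissible (`AdmissibleWeight`, `RegularWith.exists_lintegral_sq_mul_weight_le`). Two kinds of
weights are admissible: `u^{1/r}` with `u` in Muckenhoupt's class `A₁`, and `u^{-b}` with `u ∈ A₁`
and `0 < b ≤ (2 - s)/s`. The loss `2^{kn}` of the crude comparison of averages over `B(x, t)` and
`B(x, 2^k t)` does not appear, because `A_R` is symmetric and `A₁` weights dominate their averages.

*Extrapolation.* An `L²(w)` bound for a single operator with constants independent of `z` sums to an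
`L²(w)` bound for square functions. For `p > 2` it is tested on an `A₁` majorant of the function
that realizes the `L^{p/2}` norm by duality; for `p < 2` it is combined with Hölder's inequality and
a negative power of an `A₁` majorant of a power of the square function of the `f_j`
(`RegularWith.exists_lintegral_rpow_le_of_admissibleWeight`). The majorants come from Rubio de
Francia's iteration of the Hardy–Littlewood maximal function, which is bounded on `L^e`, `e > 1`, by
Vitali's covering lemma.

*`R`-boundedness.* By Khintchine's inequalities in the Hilbert space `V`, random sums and square
functions have comparable `L^p` norms, so that the square function estimates give `R`-boundedness on
the dense subspace `L^p ∩ L²`, and then on `L^p`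
(`SquareFunctionEstimates.exists_isRBounded_extension`).
-/

/-! ### Averages over balls in regular spaces -/

/-- The volume profile `(r ∧ diam X) ^ n` of balls of radius `r` in an `n`-regular space. -/
noncomputable def ballVol (X : Type*) [MetricSpace X] (n r : ℝ) : ℝ≥0∞ :=
  min (ENNReal.ofReal r) (Metric.ediam (Set.univ : Set X)) ^ n

/-- Regularity with fixed constants on a space of positive diameter. -/
structure RegularWith {X : Type*} [MetricSpace X] [MeasurableSpace X] (μ : Measure X)
    (n : ℝ) (c C : ℝ≥0) : Prop where
  dim_pos : 0 < n
  const_pos : 0 < c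
  diam_ne_zero : Metric.ediam (Set.univ : Set X) ≠ 0
  lower : ∀ (x : X) (r : ℝ), 0 < r → (c : ℝ≥0∞) * ballVol X n r ≤ μ (Metric.ball x r)
  upper : ∀ (x : X) (r : ℝ), 0 < r → μ (Metric.ball x r) ≤ (C : ℝ≥0∞) * ballVol X n r

/-- The mean of `g` over the ball `B(x, r)`, normalized by the volume profile instead of by
`μ (B(x, r))`; the two normalizations are comparable. -/
noncomputable def ballAvg {X : Type*} [MetricSpace X] [MeasurableSpace X] (μ : Measure X)
    (n r : ℝ) (g : X → ℝ≥0∞) (x : X) : ℝ≥0∞ :=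
  (ballVol X n r)⁻¹ * ∫⁻ y in Metric.ball x r, g y ∂μ

/-- Jensen's inequality for `t ↦ t ^ c` and a finite measure that need not be normalized. -/
theorem lintegral_rpow_le_measure_mul {α : Type*} [MeasurableSpace α] (ν : Measure α) {c : ℝ}
    (hc : 1 ≤ c) {f : α → ℝ≥0∞} (hf : AEMeasurable f ν) :
    (∫⁻ a, f a ∂ν) ^ c ≤ ν Set.univ ^ (c - 1) * ∫⁻ a, f a ^ c ∂ν := by
  rcases hc.eq_or_lt with rfl | hc
  · simp
  have hc0 : 0 < c := by linarith
  have hcc : c.HolderConjugate (c.conjExponent) := Real.HolderConjugate.conjExponent hc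
  have h := ENNReal.lintegral_mul_le_Lp_mul_Lq ν hcc hf (aemeasurable_const (b := (1 : ℝ≥0∞)))
  simp only [Pi.mul_apply, mul_one, ENNReal.one_rpow, lintegral_const, one_mul] at h
  calc (∫⁻ a, f a ∂ν) ^ c
      ≤ ((∫⁻ a, f a ^ c ∂ν) ^ (1 / c) * ν Set.univ ^ (1 / c.conjExponent)) ^ c := by gcongr
    _ = ν Set.univ ^ (c - 1) * ∫⁻ a, f a ^ c ∂ν := by
      rw [ENNReal.mul_rpow_of_nonneg _ _ hc0.le, ← ENNReal.rpow_mul, ← ENNReal.rpow_mul,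
        one_div_mul_cancel hc0.ne', ENNReal.rpow_one, mul_comm]
      congr 2
      rw [Real.conjExponent]
      field_simp

/-- Jensen's inequality for weighted series. -/
theorem tsum_mul_rpow_le {c : ℝ} (hc : 1 ≤ c) (w a : ℕ → ℝ≥0∞) :
    (∑' k, w k * a k) ^ c ≤ (∑' k, w k) ^ (c - 1) * ∑' k, w k * a k ^ c := by
  have key : ∀ f : ℕ → ℝ≥0∞, ∫⁻ k, f k ∂(Measure.count.withDensity w) = ∑' k, w k * f k := by
    intro f
    rw [lintegral_withDensity_eq_lintegral_mul _ (measurable_of_countable w)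
      (measurable_of_countable f), lintegral_count]
    rfl
  have h := lintegral_rpow_le_measure_mul (Measure.count.withDensity w) hc
    (measurable_of_countable a).aemeasurable
  rwa [key, key, ← lintegral_one, key, tsum_congr (fun k => mul_one (w k))] at h

theorem ballVol_mul_le {X : Type*} [MetricSpace X] {n : ℝ} (hn : 0 ≤ n) {a : ℝ} (ha : 1 ≤ a)
    (r : ℝ) :
    ballVol X n (a * r) ≤ ENNReal.ofReal a ^ n * ballVol X n r := by
  unfold ballVol
  rw [← ENNReal.mul_rpow_of_nonneg _ _ hn, mul_min, ENNReal.ofReal_mul (by linarith)]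
  gcongr
  exact le_mul_of_one_le_left (by positivity) (by simpa using ENNReal.ofReal_le_ofReal ha)

section Geometry

variable {X : Type*} [MetricSpace X] [MeasurableSpace X] {μ : Measure X} {n : ℝ} {c C : ℝ≥0}

namespace RegularWith

variable (h : RegularWith μ n c C)
include h

theorem ballVol_ne_zero {r : ℝ} (hr : 0 < r) : ballVol X n r ≠ 0 := by
  unfold ballVol
  refine (ENNReal.rpow_pos (lt_min (by simpa using hr) (pos_iff_ne_zero.2 h.diam_ne_zero)) ?_).ne'
  exact ne_top_of_le_ne_top ENNReal.ofReal_ne_top (min_le_left _ _)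

theorem ballVol_ne_top (r : ℝ) : ballVol X n r ≠ ∞ := by
  unfold ballVol
  exact ENNReal.rpow_ne_top_of_nonneg h.dim_pos.le
    (ne_top_of_le_ne_top ENNReal.ofReal_ne_top (min_le_left _ _))

theorem measure_ball_lt_top (x : X) (r : ℝ) : μ (Metric.ball x r) < ∞ := by
  rcases le_or_gt r 0 with hr | hr
  · simp [Metric.ball_eq_empty.2 hr]
  · exact (h.upper x r hr).trans_lt
      (ENNReal.mul_lt_top ENNReal.coe_lt_top (h.ballVol_ne_top r).lt_top)

theorem measure_ball_pos (x : X) {r : ℝ} (hr : 0 < r) : 0 < μ (Metric.ball x r) :=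
  (ENNReal.mul_pos (by exact_mod_cast h.const_pos.ne') (h.ballVol_ne_zero hr)).trans_le
    (h.lower x r hr)

theorem sigmaFinite : SigmaFinite μ := by
  obtain _ | ⟨⟨x⟩⟩ := isEmpty_or_nonempty X
  · rw [μ.eq_zero_of_isEmpty]; infer_instance
  · refine ⟨⟨⟨fun k => Metric.ball x k, fun _ => trivial, fun k => h.measure_ball_lt_top x k, ?_⟩⟩⟩
    exact Metric.iUnion_ball_nat x

/-- Regular spaces are separable: a maximal separated set is countable, because the balls around
its points are disjoint and have positive measure. -/
theorem secondCountableTopology [BorelSpace X] : SecondCountableTopology X := by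
  have := h.sigmaFinite
  refine Metric.secondCountable_of_almost_dense_set fun ε hε => ?_
  obtain ⟨u, -, hu, hcov⟩ := Vitali.exists_disjoint_subfamily_covering_enlargement_closedBall
    (Set.univ : Set X) id (fun _ => ε / 4) (ε / 4) (fun _ _ => le_rfl) 4 (by norm_num)
  refine ⟨u, ?_, fun x => ?_⟩
  · have := Measure.countable_meas_pos_of_disjoint_iUnion (μ := μ)
      (As := fun a : u => Metric.ball (a : X) (ε / 4)) (fun _ => Metric.isOpen_ball.measurableSet)
      (fun a b hab => (hu a.2 b.2 (fun e => hab (Subtype.ext e))).mono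
        Metric.ball_subset_closedBall Metric.ball_subset_closedBall)
    refine Set.countable_coe_iff.1 (Set.countable_univ_iff.1 (this.mono fun a _ => ?_))
    exact h.measure_ball_pos (a : X) (by positivity : 0 < ε / 4)
  · obtain ⟨b, hb, hsub⟩ := hcov x trivial
    refine ⟨b, hb, ?_⟩
    have := hsub (Metric.mem_closedBall_self (by positivity))
    simpa [show 4 * (ε / 4) = ε by ring] using this

end RegularWith

theorem ballAvg_eq_lintegral (r : ℝ) (g : X → ℝ≥0∞) (x : X) :
    ballAvg μ n r g x = ∫⁻ y, g y ∂((ballVol X n r)⁻¹ • μ.restrict (Metric.ball x r)) := by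
  rw [lintegral_smul_measure, ballAvg, smul_eq_mul]

theorem ballAvg_mono {g g' : X → ℝ≥0∞} {r : ℝ} {x : X} (hg : ∀ y ∈ Metric.ball x r, g y ≤ g' y)
    [OpensMeasurableSpace X] : ballAvg μ n r g x ≤ ballAvg μ n r g' x := by
  unfold ballAvg
  gcongr 1
  exact setLIntegral_mono' Metric.isOpen_ball.measurableSet hg

theorem ballAvg_mono_ae {g g' : X → ℝ≥0∞} {r : ℝ} {x : X} (hg : ∀ᵐ y ∂μ, g y ≤ g' y) :
    ballAvg μ n r g x ≤ ballAvg μ n r g' x := by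
  unfold ballAvg
  gcongr 1
  exact lintegral_mono_ae (ae_restrict_of_ae hg)

theorem ballAvg_const_mul {a : ℝ≥0∞} (ha : a ≠ ∞) (g : X → ℝ≥0∞) (r : ℝ) (x : X) :
    ballAvg μ n r (fun y => a * g y) x = a * ballAvg μ n r g x := by
  rw [ballAvg_eq_lintegral, ballAvg_eq_lintegral, lintegral_const_mul' _ _ ha]

theorem lowerSemicontinuous_ballAvg (g : X → ℝ≥0∞) (r : ℝ) :
    LowerSemicontinuous (ballAvg μ n r g) := by
  intro x a hax
  have hU : Metric.ball x r = ⋃ k : ℕ, Metric.ball x (r - 1 / (k + 1)) := by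
    ext y
    simp only [Metric.mem_ball, Set.mem_iUnion]
    constructor
    · intro hy
      obtain ⟨k, hk⟩ := exists_nat_one_div_lt (sub_pos.2 hy)
      exact ⟨k, by linarith⟩
    · rintro ⟨k, hk⟩
      have : (0 : ℝ) < 1 / (k + 1) := by positivity
      linarith
  have hdir : Directed (· ⊆ ·) fun k : ℕ => Metric.ball x (r - 1 / ((k : ℝ) + 1)) := by
    refine (monotone_nat_of_le_succ fun k => Metric.ball_subset_ball ?_).directed_le
    gcongr
    simp
  simp only [ballAvg] at hax ⊢
  rw [hU, setLIntegral_iUnion_of_directed _ hdir, ENNReal.mul_iSup, gt_iff_lt, lt_iSup_iff] at hax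
  obtain ⟨k, hk⟩ := hax
  filter_upwards [Metric.ball_mem_nhds x (by positivity : (0 : ℝ) < 1 / (k + 1))] with y hy
  refine hk.trans_le ?_
  gcongr
  refine Metric.ball_subset_ball' ?_
  rw [Metric.mem_ball, dist_comm] at hy
  linarith

theorem measurable_ballAvg [OpensMeasurableSpace X] (g : X → ℝ≥0∞) (r : ℝ) :
    Measurable (ballAvg μ n r g) := (lowerSemicontinuous_ballAvg g r).measurable

namespace RegularWith

variable (h : RegularWith μ n c C)
include h

theorem normalized_measure_le (x : X) {r : ℝ} (hr : 0 < r) :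
    ((ballVol X n r)⁻¹ • μ.restrict (Metric.ball x r)) Set.univ ≤ C := by
  simp only [Measure.smul_apply, Measure.restrict_apply_univ, smul_eq_mul]
  calc (ballVol X n r)⁻¹ * μ (Metric.ball x r)
      ≤ (ballVol X n r)⁻¹ * (C * ballVol X n r) := by gcongr; exact h.upper x r hr
    _ = C := by
      rw [mul_comm, mul_assoc, ENNReal.mul_inv_cancel (h.ballVol_ne_zero hr) (h.ballVol_ne_top r),
        mul_one]

theorem ballAvg_const_le (a : ℝ≥0∞) {r : ℝ} (hr : 0 < r) (x : X) :
    ballAvg μ n r (fun _ => a) x ≤ C * a := by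
  rw [ballAvg_eq_lintegral, lintegral_const, mul_comm]
  gcongr
  exact h.normalized_measure_le x hr

theorem ballAvg_rpow_le {e : ℝ} (he : 1 ≤ e) {g : X → ℝ≥0∞} (hg : Measurable g) {r : ℝ}
    (hr : 0 < r) (x : X) :
    ballAvg μ n r g x ^ e ≤ (C : ℝ≥0∞) ^ (e - 1) * ballAvg μ n r (fun y => g y ^ e) x := by
  rw [ballAvg_eq_lintegral, ballAvg_eq_lintegral]
  refine (lintegral_rpow_le_measure_mul _ he hg.aemeasurable).trans ?_
  gcongr ?_ * _
  exact ENNReal.rpow_le_rpow (h.normalized_measure_le x hr) (by linarith)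

/-- Doubling: enlarging a ball by a factor `a` costs at most `a ^ n` in the average. -/
theorem ballAvg_le_of_subset {g : X → ℝ≥0∞} {r a : ℝ} (ha : 1 ≤ a) {x y : X}
    (hxy : Metric.ball x r ⊆ Metric.ball y (a * r)) :
    ballAvg μ n r g x ≤ ENNReal.ofReal a ^ n * ballAvg μ n (a * r) g y := by
  unfold ballAvg
  rw [← mul_assoc]
  have ha0 : ENNReal.ofReal a ≠ 0 := by simpa using by linarith
  have hA0 : ENNReal.ofReal a ^ n ≠ 0 := (ENNReal.rpow_pos (pos_iff_ne_zero.2 ha0) (by simp)).ne'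
  have hA1 : ENNReal.ofReal a ^ n ≠ ∞ := ENNReal.rpow_ne_top_of_nonneg h.dim_pos.le (by simp)
  gcongr
  calc (ballVol X n r)⁻¹
      = ENNReal.ofReal a ^ n * (ENNReal.ofReal a ^ n * ballVol X n r)⁻¹ := by
        rw [ENNReal.mul_inv (Or.inl hA0) (Or.inl hA1), ← mul_assoc,
          ENNReal.mul_inv_cancel hA0 hA1, one_mul]
    _ ≤ ENNReal.ofReal a ^ n * (ballVol X n (a * r))⁻¹ := by
        gcongr
        exact ballVol_mul_le h.dim_pos.le ha r

end RegularWith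

/-- Averaging over balls of a fixed radius is symmetric, because `y ∈ B(x, r)` is. -/
theorem lintegral_ballAvg_mul [BorelSpace X] [SecondCountableTopology X] [SFinite μ]
    {f g : X → ℝ≥0∞} (hf : Measurable f) (hg : Measurable g) (r : ℝ) :
    ∫⁻ x, ballAvg μ n r f x * g x ∂μ = ∫⁻ x, f x * ballAvg μ n r g x ∂μ := by
  have hS : MeasurableSet {z : X × X | dist z.1 z.2 < r} :=
    measurableSet_lt measurable_dist measurable_const
  have hm : Measurable (Function.uncurry fun x y : X =>
      (Metric.ball x r).indicator f y * g x) := by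
    have : Measurable ({z : X × X | dist z.1 z.2 < r}.indicator fun z => f z.2) :=
      (hf.comp measurable_snd).indicator hS
    convert this.mul (hg.comp measurable_fst) using 1
    ext ⟨x, y⟩
    simp only [Set.indicator, Function.uncurry, Metric.mem_ball, dist_comm y x, Pi.mul_apply,
      Function.comp_apply, Set.mem_ofPred_eq]
  have hball : ∀ x : X, MeasurableSet (Metric.ball x r) := fun x => Metric.isOpen_ball.measurableSet
  calc ∫⁻ x, ballAvg μ n r f x * g x ∂μ
      = ∫⁻ x, (ballVol X n r)⁻¹ * ∫⁻ y, (Metric.ball x r).indicator f y * g x ∂μ ∂μ := by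
        refine lintegral_congr fun x => ?_
        rw [lintegral_mul_const _ (hf.indicator (hball x)), lintegral_indicator (hball x), ballAvg,
          mul_assoc]
    _ = (ballVol X n r)⁻¹ * ∫⁻ x, ∫⁻ y, (Metric.ball x r).indicator f y * g x ∂μ ∂μ :=
        lintegral_const_mul _ hm.lintegral_prod_right'
    _ = (ballVol X n r)⁻¹ * ∫⁻ y, ∫⁻ x, (Metric.ball x r).indicator f y * g x ∂μ ∂μ := by
        rw [lintegral_lintegral_swap hm.aemeasurable]
    _ = (ballVol X n r)⁻¹ * ∫⁻ y, f y * ∫⁻ x in Metric.ball y r, g x ∂μ ∂μ := by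
        congr 1
        refine lintegral_congr fun y => ?_
        rw [← lintegral_indicator (hball y), ← lintegral_const_mul _ (hg.indicator (hball y))]
        refine lintegral_congr fun x => ?_
        simp only [Set.indicator, Metric.mem_ball, dist_comm y x]
        split_ifs <;> simp
    _ = ∫⁻ y, (ballVol X n r)⁻¹ * (f y * ∫⁻ x in Metric.ball y r, g x ∂μ) ∂μ := by
        refine (lintegral_const_mul _ (hf.mul ?_)).symm
        have hm' : Measurable (Function.uncurry fun x y : X =>
            (Metric.ball x r).indicator g y) := by
          convert (hg.comp measurable_snd).indicator hS using 1
          ext ⟨x, y⟩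
          simp only [Set.indicator, Function.uncurry, Metric.mem_ball, dist_comm y x,
            Function.comp_apply, Set.mem_ofPred_eq]
        convert hm'.lintegral_prod_right' (ν := μ) using 1
        ext x
        simp only [Function.uncurry_apply_pair, lintegral_indicator (hball x)]
    _ = ∫⁻ x, f x * ballAvg μ n r g x ∂μ := by
        refine lintegral_congr fun y => ?_
        rw [ballAvg]
        ring

end Geometry

/-! ### The Hardy–Littlewood maximal function -/

/-- The centred Hardy–Littlewood maximal function, formed with the averages `ballAvg`. -/
noncomputable def maximalFun {X : Type*} [MetricSpace X] [MeasurableSpace X] (μ : Measure X)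
    (n : ℝ) (g : X → ℝ≥0∞) (x : X) : ℝ≥0∞ :=
  ⨆ (r : ℝ) (_ : 0 < r), ballAvg μ n r g x

/-- The layer cake formula for a single extended nonnegative number. -/
theorem lintegral_rpow_sub_one_of_lt {e : ℝ} (he : 0 < e) (a : ℝ≥0∞) :
    ∫⁻ t in Set.Ioi (0 : ℝ), {t : ℝ | ENNReal.ofReal t < a}.indicator
      (fun t => ENNReal.ofReal (t ^ (e - 1))) t = a ^ e / ENNReal.ofReal e := by
  have hm : ∀ a : ℝ≥0∞, MeasurableSet {t : ℝ | ENNReal.ofReal t < a} := fun a =>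
    measurableSet_lt ENNReal.measurable_ofReal measurable_const
  have hfin : ∀ b : ℝ, 0 ≤ b → ∫⁻ t in Set.Ioi (0 : ℝ), {t : ℝ | ENNReal.ofReal t <
      ENNReal.ofReal b}.indicator (fun t => ENNReal.ofReal (t ^ (e - 1))) t
      = ENNReal.ofReal b ^ e / ENNReal.ofReal e := by
    intro b hb
    rw [lintegral_indicator (hm _), Measure.restrict_restrict (hm _)]
    have hset : {t : ℝ | ENNReal.ofReal t < ENNReal.ofReal b} ∩ Set.Ioi 0 = Set.Ioo 0 b := by
      ext t
      simp only [Set.mem_inter_iff, Set.mem_ofPred_eq, Set.mem_Ioi, Set.mem_Ioo]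
      refine ⟨fun ⟨h1, h2⟩ => ⟨h2, (ENNReal.ofReal_lt_ofReal_iff_of_nonneg h2.le).1 h1⟩,
        fun ⟨h1, h2⟩ => ⟨(ENNReal.ofReal_lt_ofReal_iff_of_nonneg h1.le).2 h2, h1⟩⟩
    have hint : IntervalIntegrable (fun t : ℝ => t ^ (e - 1)) volume 0 b :=
      intervalIntegral.intervalIntegrable_rpow' (by linarith)
    rw [hset, Measure.restrict_congr_set Ioo_ae_eq_Ioc, ← ofReal_integral_eq_lintegral_ofReal,
      ← intervalIntegral.integral_of_le hb, integral_rpow (Or.inl (by linarith)),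
      ENNReal.ofReal_rpow_of_nonneg hb he.le, ← ENNReal.ofReal_div_of_pos he]
    · simp [Real.zero_rpow he.ne']
    · exact (intervalIntegrable_iff_integrableOn_Ioc_of_le hb).1 hint
    · filter_upwards [ae_restrict_mem measurableSet_Ioc] with t ht
      exact Real.rpow_nonneg ht.1.le _
  rcases eq_or_ne a ∞ with rfl | ha
  · rw [ENNReal.top_rpow_of_pos he, ENNReal.top_div_of_ne_top ENNReal.ofReal_ne_top]
    refine ENNReal.eq_top_of_forall_nnreal_le fun r => ?_
    have hr : (r : ℝ≥0∞) = ENNReal.ofReal (((r : ℝ) * e) ^ e⁻¹) ^ e / ENNReal.ofReal e := by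
      rw [ENNReal.ofReal_rpow_of_nonneg (by positivity) he.le, ← Real.rpow_mul (by positivity),
        inv_mul_cancel₀ he.ne', Real.rpow_one, ← ENNReal.ofReal_div_of_pos he,
        mul_div_cancel_right₀ _ he.ne', ENNReal.ofReal_coe_nnreal]
    rw [hr, ← hfin _ (by positivity)]
    refine lintegral_mono fun t => Set.indicator_le_indicator_of_subset ?_ (by simp) t
    intro t _
    simp
  · simpa [ENNReal.ofReal_toReal ha] using hfin a.toReal ENNReal.toReal_nonneg

section Maximal

variable {X : Type*} [MetricSpace X] [MeasurableSpace X] {μ : Measure X} {n : ℝ} {c C : ℝ≥0}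

theorem ballAvg_le_maximalFun (g : X → ℝ≥0∞) {r : ℝ} (hr : 0 < r) (x : X) :
    ballAvg μ n r g x ≤ maximalFun μ n g x :=
  le_iSup₂ (f := fun (r : ℝ) (_ : 0 < r) => ballAvg μ n r g x) r hr

theorem measurable_maximalFun [OpensMeasurableSpace X] (g : X → ℝ≥0∞) :
    Measurable (maximalFun μ n g) :=
  (lowerSemicontinuous_iSup fun r => lowerSemicontinuous_iSup fun _ =>
    lowerSemicontinuous_ballAvg g r).measurable

theorem maximalFun_const_mul_le {a : ℝ≥0∞} (ha : a ≠ ∞) (g : X → ℝ≥0∞) (x : X) :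
    maximalFun μ n (fun y => a * g y) x ≤ a * maximalFun μ n g x := by
  refine iSup₂_le fun r hr => ?_
  rw [ballAvg_const_mul ha]
  gcongr
  exact ballAvg_le_maximalFun g hr x

theorem maximalFun_tsum_le {g : ℕ → X → ℝ≥0∞} (hg : ∀ k, Measurable (g k)) (x : X) :
    maximalFun μ n (fun y => ∑' k, g k y) x ≤ ∑' k, maximalFun μ n (g k) x := by
  refine iSup₂_le fun r hr => ?_
  rw [ballAvg_eq_lintegral, lintegral_tsum fun k => (hg k).aemeasurable]
  refine ENNReal.tsum_le_tsum fun k => ?_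
  rw [← ballAvg_eq_lintegral]
  exact ballAvg_le_maximalFun _ hr x

namespace RegularWith

variable (h : RegularWith μ n c C)
include h

/-- The Hardy–Littlewood maximal function is of weak type `(1, 1)`. -/
theorem mul_measure_maximalFun_le [BorelSpace X] (g : X → ℝ≥0∞) {a : ℝ≥0∞} :
    a * μ {x | a < maximalFun μ n g x}
      ≤ C * ENNReal.ofReal 5 ^ n * ∫⁻ x, g x ∂μ := by
  have := h.sigmaFinite
  let S : ℕ → Set X := fun R => {x | ∃ r : ℝ, 0 < r ∧ r ≤ R ∧ a < ballAvg μ n r g x}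
  have hSU : {x | a < maximalFun μ n g x} = ⋃ R, S R := by
    ext x
    simp only [Set.mem_ofPred_eq, Set.mem_iUnion, maximalFun, lt_iSup_iff, S]
    constructor
    · rintro ⟨r, hr, hx⟩
      obtain ⟨R, hR⟩ := exists_nat_ge r
      exact ⟨R, r, hr, hR, hx⟩
    · rintro ⟨R, r, hr, -, hx⟩
      exact ⟨r, hr, hx⟩
  have hSm : Monotone S := fun R R' hRR' x ⟨r, hr, hrR, hx⟩ =>
    ⟨r, hr, hrR.trans (by exact_mod_cast hRR'), hx⟩
  rw [hSU, hSm.measure_iUnion, ENNReal.mul_iSup]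
  -- radii bounded by `R`, as Vitali's covering lemma requires; the bound does not depend on `R`
  refine iSup_le fun R => ?_
  choose! r hr0 hrR hra using fun (x : X) (hx : x ∈ S R) => hx
  obtain ⟨u, huS, hdisj, hcov⟩ := Vitali.exists_disjoint_subfamily_covering_enlargement_closedBall
    (S R) id r R (fun x hx => hrR x hx) 4 (by norm_num)
  have hdisj' : Pairwise (Function.onFun Disjoint fun b : u => Metric.ball (b : X) (r b)) :=
    fun b b' hb => (hdisj b.2 b'.2 (fun e => hb (Subtype.ext e))).mono
      Metric.ball_subset_closedBall Metric.ball_subset_closedBall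
  have hu : Countable u := by
    have := Measure.countable_meas_pos_of_disjoint_iUnion (μ := μ)
      (fun b : u => Metric.isOpen_ball.measurableSet) hdisj'
    exact Set.countable_univ_iff.1
      (this.mono fun b _ => h.measure_ball_pos (b : X) (hr0 _ (huS b.2)))
  have hsub : S R ⊆ ⋃ b : u, Metric.ball (b : X) (5 * r b) := by
    intro x hx
    obtain ⟨b, hb, hxb⟩ := hcov x hx
    have hrb := hr0 b (huS hb)
    refine Set.mem_iUnion.2 ⟨⟨b, hb⟩, ?_⟩
    have := hxb (Metric.mem_closedBall_self (hr0 x hx).le)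
    rw [Metric.mem_closedBall] at this
    rw [Metric.mem_ball]
    simp only [id] at this
    linarith
  calc a * μ (S R)
      ≤ a * ∑' b : u, μ (Metric.ball (b : X) (5 * r b)) := by
        gcongr
        exact (measure_mono hsub).trans (measure_iUnion_le _)
    _ = ∑' b : u, a * μ (Metric.ball (b : X) (5 * r b)) := ENNReal.tsum_mul_left.symm
    _ ≤ ∑' b : u, C * ENNReal.ofReal 5 ^ n * ∫⁻ y in Metric.ball (b : X) (r b), g y ∂μ := by
        refine ENNReal.tsum_le_tsum fun b => ?_
        have hrb := hr0 b (huS b.2)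
        have hav : a * ballVol X n (r b) ≤ ∫⁻ y in Metric.ball (b : X) (r b), g y ∂μ := by
          have := (hra b (huS b.2)).le
          rw [ballAvg, ← ENNReal.div_eq_inv_mul] at this
          exact (ENNReal.le_div_iff_mul_le (Or.inl (h.ballVol_ne_zero hrb))
            (Or.inl (h.ballVol_ne_top _))).1 this
        calc a * μ (Metric.ball (b : X) (5 * r b))
            ≤ a * (C * (ENNReal.ofReal 5 ^ n * ballVol X n (r b))) := by
              gcongr
              refine (h.upper _ _ (by positivity)).trans ?_
              gcongr
              exact ballVol_mul_le h.dim_pos.le (by norm_num) _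
          _ = C * ENNReal.ofReal 5 ^ n * (a * ballVol X n (r b)) := by ring
          _ ≤ _ := by gcongr
    _ = C * ENNReal.ofReal 5 ^ n * ∫⁻ y in ⋃ b : u, Metric.ball (b : X) (r b), g y ∂μ := by
        rw [ENNReal.tsum_mul_left,
          lintegral_iUnion (fun b => Metric.isOpen_ball.measurableSet) hdisj']
    _ ≤ _ := by
        gcongr
        exact Measure.restrict_le_self

/-- The part of `g` below a small multiple of the level `t` does not contribute to
`{M g > t}`; hence the weak type bound improves to an integral over a superlevel set of `g`. -/
theorem measure_maximalFun_le [BorelSpace X] {g : X → ℝ≥0∞} (hg : Measurable g)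
    {t : ℝ} (ht : 0 < t) :
    μ {x | ENNReal.ofReal t < maximalFun μ n g x}
      ≤ 2 * C * ENNReal.ofReal 5 ^ n * (ENNReal.ofReal t)⁻¹
        * ∫⁻ x, {x | ENNReal.ofReal t < 2 * (C + 1) * g x}.indicator g x ∂μ := by
  set T := ENNReal.ofReal t with hT
  have hT0 : T ≠ 0 := by simpa [hT] using ht
  have hT1 : T ≠ ∞ := ENNReal.ofReal_ne_top
  set g' : X → ℝ≥0∞ := {x | T < 2 * (C + 1) * g x}.indicator g with hg'
  have hg'm : Measurable g' := hg.indicator (measurableSet_lt measurable_const (hg.const_mul _))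
  set b : ℝ≥0∞ := T / (2 * (C + 1)) with hb
  have hC0 : (2 * (C + 1) : ℝ≥0∞) ≠ 0 := by positivity
  have hC1 : (2 * (C + 1) : ℝ≥0∞) ≠ ∞ := by finiteness
  have hgg : ∀ x, g x ≤ g' x + b := by
    intro x
    by_cases hx : T < 2 * (C + 1) * g x
    · simp [hg', hx]
    · simp only [hg', Set.indicator, Set.mem_ofPred_eq, hx, if_false, zero_add]
      rw [hb, ENNReal.le_div_iff_mul_le (Or.inl hC0) (Or.inl hC1), mul_comm]
      exact not_lt.1 hx
  have hbC : C * b ≤ T / 2 := by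
    calc (C : ℝ≥0∞) * b ≤ (C + 1) * b := by gcongr; exact le_self_add
      _ = T / 2 := by
        rw [hb, ENNReal.div_eq_inv_mul, ENNReal.mul_inv (by simp) (by simp), mul_comm 2⁻¹,
          ← mul_assoc, ← mul_assoc, ENNReal.mul_inv_cancel (by simp) (by finiteness), one_mul,
          ENNReal.div_eq_inv_mul]
  have hM : ∀ x, maximalFun μ n g x ≤ maximalFun μ n g' x + T / 2 := by
    intro x
    refine iSup₂_le fun r hr => ?_
    calc ballAvg μ n r g x ≤ ballAvg μ n r (fun y => g' y + b) x := ballAvg_mono fun y _ => hgg y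
      _ = ballAvg μ n r g' x + ballAvg μ n r (fun _ => b) x := by
        rw [ballAvg_eq_lintegral, lintegral_add_left hg'm, ← ballAvg_eq_lintegral,
          ← ballAvg_eq_lintegral]
      _ ≤ _ := add_le_add (ballAvg_le_maximalFun g' hr x) ((h.ballAvg_const_le b hr x).trans hbC)
  have hsub : {x | T < maximalFun μ n g x} ⊆ {x | T / 2 < maximalFun μ n g' x} := by
    intro x hx
    by_contra hcon
    have h1 : maximalFun μ n g' x ≤ T / 2 := not_lt.1 hcon
    have h2 : T < T / 2 + T / 2 := lt_of_lt_of_le hx ((hM x).trans (by gcongr))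
    rw [ENNReal.add_halves] at h2
    exact lt_irrefl _ h2
  have hw := h.mul_measure_maximalFun_le g' (a := T / 2)
  calc μ {x | T < maximalFun μ n g x} ≤ μ {x | T / 2 < maximalFun μ n g' x} := measure_mono hsub
    _ = 2 * T⁻¹ * (T / 2 * μ {x | T / 2 < maximalFun μ n g' x}) := by
      rw [← mul_assoc, ENNReal.div_eq_inv_mul, mul_comm 2⁻¹ T, mul_assoc 2, ← mul_assoc T⁻¹,
        ENNReal.inv_mul_cancel hT0 hT1, one_mul, ENNReal.mul_inv_cancel (by simp) (by simp),
        one_mul]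
    _ ≤ 2 * T⁻¹ * (C * ENNReal.ofReal 5 ^ n * ∫⁻ x, g' x ∂μ) := by gcongr
    _ = _ := by ring

/-- The Hardy–Littlewood maximal function is bounded on `L^e` for `1 < e < ∞`: integrate the
improved weak type bound over all levels and interchange the integrals. -/
theorem exists_lintegral_maximalFun_rpow_le [BorelSpace X] {e : ℝ} (he : 1 < e) :
    ∃ K : ℝ≥0∞, K ≠ ∞ ∧ ∀ g : X → ℝ≥0∞, Measurable g →
      ∫⁻ x, maximalFun μ n g x ^ e ∂μ ≤ K * ∫⁻ x, g x ^ e ∂μ := by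
  have := h.sigmaFinite
  set W : ℝ≥0∞ := 2 * C * ENNReal.ofReal 5 ^ n with hW
  set D : ℝ≥0∞ := 2 * (C + 1) with hD
  have hn := h.dim_pos.le
  have hW1 : W ≠ ∞ := by
    have : ENNReal.ofReal 5 ^ n ≠ ∞ := ENNReal.rpow_ne_top_of_nonneg hn (by simp)
    finiteness
  have hD1 : D ≠ ∞ := by finiteness
  have he0 : ENNReal.ofReal e ≠ 0 := by simpa using by linarith
  have he1 : ENNReal.ofReal (e - 1) ≠ 0 := by simpa using by linarith
  refine ⟨ENNReal.ofReal e * W * (D ^ (e - 1) / ENNReal.ofReal (e - 1)), ?_, fun g hg => ?_⟩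
  · have : D ^ (e - 1) ≠ ∞ := ENNReal.rpow_ne_top_of_nonneg (by linarith) hD1
    finiteness
  have hMm := measurable_maximalFun (μ := μ) (n := n) g
  have hpow : ∀ p : ℝ, Measurable fun t : ℝ => ENNReal.ofReal (t ^ p) := fun p =>
    (measurable_id.pow_const p).ennreal_ofReal
  have hjoint : ∀ (u : X → ℝ≥0∞) (p : ℝ), Measurable u → Measurable (Function.uncurry
      fun (x : X) (t : ℝ) => {t : ℝ | ENNReal.ofReal t < u x}.indicator
        (fun t => ENNReal.ofReal (t ^ p)) t) := by
    intro u p hu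
    have hS : MeasurableSet {z : X × ℝ | ENNReal.ofReal z.2 < u z.1} :=
      measurableSet_lt (ENNReal.measurable_ofReal.comp measurable_snd) (hu.comp measurable_fst)
    exact ((hpow p).comp measurable_snd).indicator hS
  have hdiv : ∀ (a : ℝ≥0∞) {p : ℝ}, ENNReal.ofReal p ≠ 0 →
      a = ENNReal.ofReal p * (a / ENNReal.ofReal p) := fun a p hp =>
    (ENNReal.mul_div_cancel hp ENNReal.ofReal_ne_top).symm
  calc ∫⁻ x, maximalFun μ n g x ^ e ∂μ
      = ENNReal.ofReal e * ∫⁻ x, maximalFun μ n g x ^ e / ENNReal.ofReal e ∂μ := by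
        rw [← lintegral_const_mul _ ((hMm.pow_const e).div_const _)]
        exact lintegral_congr fun x => hdiv _ he0
    _ = ENNReal.ofReal e * ∫⁻ t in Set.Ioi (0 : ℝ), ∫⁻ x,
          {t : ℝ | ENNReal.ofReal t < maximalFun μ n g x}.indicator
            (fun t => ENNReal.ofReal (t ^ (e - 1))) t ∂μ := by
        rw [lintegral_lintegral_swap, lintegral_congr]
        · intro x
          rw [lintegral_rpow_sub_one_of_lt (by linarith)]
        · exact ((hjoint _ _ hMm).comp measurable_swap).aemeasurable
    _ ≤ ENNReal.ofReal e * ∫⁻ t in Set.Ioi (0 : ℝ), W * ∫⁻ x, g x *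
          {t : ℝ | ENNReal.ofReal t < D * g x}.indicator
            (fun t => ENNReal.ofReal (t ^ (e - 1 - 1))) t ∂μ := by
        gcongr 1
        refine setLIntegral_mono' measurableSet_Ioi fun t (ht : 0 < t) => ?_
        have hset : MeasurableSet {x | ENNReal.ofReal t < maximalFun μ n g x} :=
          measurableSet_lt measurable_const hMm
        have hset' : MeasurableSet {x | ENNReal.ofReal t < D * g x} :=
          measurableSet_lt measurable_const (hg.const_mul _)
        calc ∫⁻ x, {t : ℝ | ENNReal.ofReal t < maximalFun μ n g x}.indicator
              (fun t => ENNReal.ofReal (t ^ (e - 1))) t ∂μ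
            = ENNReal.ofReal (t ^ (e - 1)) * μ {x | ENNReal.ofReal t < maximalFun μ n g x} := by
              rw [← lintegral_indicator_const hset]
              rfl
          _ ≤ ENNReal.ofReal (t ^ (e - 1)) * (W * (ENNReal.ofReal t)⁻¹
                * ∫⁻ x, {x | ENNReal.ofReal t < D * g x}.indicator g x ∂μ) := by
              gcongr
              exact h.measure_maximalFun_le hg ht
          _ = W * (ENNReal.ofReal (t ^ (e - 1 - 1)) *
                ∫⁻ x, {x | ENNReal.ofReal t < D * g x}.indicator g x ∂μ) := by
              rw [Real.rpow_sub_one ht.ne' (e - 1), ENNReal.ofReal_div_of_pos ht, div_eq_mul_inv]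
              ring
          _ = _ := by
              rw [← lintegral_const_mul _ (hg.indicator hset')]
              congr 2
              ext x
              simp only [Set.indicator, Set.mem_ofPred_eq]
              split_ifs <;> simp [mul_comm]
    _ = ENNReal.ofReal e * W * ∫⁻ x, g x * ((D * g x) ^ (e - 1) / ENNReal.ofReal (e - 1)) ∂μ := by
        rw [lintegral_const_mul' _ _ hW1, ← mul_assoc, lintegral_lintegral_swap]
        · congr 1
          refine lintegral_congr fun x => ?_
          rw [lintegral_const_mul _ ((hpow _).indicator (measurableSet_lt
            ENNReal.measurable_ofReal measurable_const)),
            lintegral_rpow_sub_one_of_lt (by linarith)]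
        · exact ((hg.comp measurable_fst).mul
            (hjoint (fun x => D * g x) _ (hg.const_mul _))).comp measurable_swap |>.aemeasurable
    _ = ENNReal.ofReal e * W * (D ^ (e - 1) / ENNReal.ofReal (e - 1)) * ∫⁻ x, g x ^ e ∂μ := by
        rw [mul_assoc (_ * _), ← lintegral_const_mul _ (hg.pow_const e)]
        congr 2
        ext x
        rw [ENNReal.mul_rpow_of_nonneg _ _ (by linarith : 0 ≤ e - 1)]
        have : g x ^ e = g x * g x ^ (e - 1) := by
          conv_lhs => rw [show e = 1 + (e - 1) by ring]
          rw [ENNReal.rpow_add_of_nonneg _ _ (by norm_num) (by linarith), ENNReal.rpow_one]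
        rw [this]
        simp only [div_eq_mul_inv]
        ring

end RegularWith

end Maximal

/-! ### `A₁` majorants and admissible weights -/

/-- The condition on a weight `w` under which operators with `L^s → L^q` off-diagonal estimates are
bounded on `L²(w)`, with `r` the conjugate exponent of `q / 2`. The constant `L` must serve all
pairs of radii `t ≤ R`. -/
def AdmissibleWeight {X : Type*} [MetricSpace X] [MeasurableSpace X] (μ : Measure X)
    (n s r : ℝ) (w : X → ℝ≥0∞) (L : ℝ≥0∞) : Prop :=
  ∀ t R : ℝ, 0 < t → t ≤ R → ∀ g : X → ℝ≥0∞, Measurable g →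
    ∫⁻ x, ballAvg μ n R (fun y => g y ^ s) x ^ (2 / s)
        * ballAvg μ n t (fun y => w y ^ r) x ^ (1 / r) ∂μ
      ≤ L * ∫⁻ x, g x ^ (2 : ℝ) * w x ∂μ

namespace RegularWith

variable {X : Type*} [MetricSpace X] [MeasurableSpace X] [BorelSpace X] {μ : Measure X} {n : ℝ}
  {c C : ℝ≥0} (h : RegularWith μ n c C)
include h

/-- Every function in `L^e` with `e > 1` has a majorant of comparable norm that satisfies
Muckenhoupt's condition `A₁` (Rubio de Francia's iteration of the maximal function). -/
theorem exists_maximalFun_le_majorant {e : ℝ} (he : 1 < e) :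
    ∃ K : ℝ≥0∞, K ≠ ∞ ∧ 1 ≤ K ∧ ∀ u : X → ℝ≥0∞, Measurable u → ∃ w : X → ℝ≥0∞, Measurable w ∧
      (∀ x, u x ≤ w x) ∧ (∀ x, maximalFun μ n w x ≤ K * w x) ∧
      ∫⁻ x, w x ^ e ∂μ ≤ K * ∫⁻ x, u x ^ e ∂μ := by
  obtain ⟨A', hA', hM⟩ := h.exists_lintegral_maximalFun_rpow_le he
  set A : ℝ≥0∞ := A' + 1 with hA
  have he0 : 0 < e := by linarith
  have hA1 : A ≠ ∞ := by finiteness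
  have hA0 : A ≠ 0 := by positivity
  -- dividing by `D ^ k` makes the iterates `M ^ k u` bounded in `L^e`; the further factor `2⁻¹ ^ k`
  -- in the majorant makes them summable
  set D : ℝ≥0∞ := A ^ e⁻¹ with hD
  have hD0 : D ≠ 0 := (ENNReal.rpow_pos (pos_iff_ne_zero.2 hA0) hA1).ne'
  have hD1 : D ≠ ∞ := ENNReal.rpow_ne_top_of_nonneg (by positivity) hA1
  have hDe : D ^ e = A := by rw [hD, ← ENNReal.rpow_mul, inv_mul_cancel₀ he0.ne', ENNReal.rpow_one]
  have hiter : ∀ (u : X → ℝ≥0∞), Measurable u → ∀ k, Measurable ((maximalFun μ n)^[k] u) := by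
    intro u hu k
    cases k with
    | zero => exact hu
    | succ k => rw [Function.iterate_succ_apply']; exact measurable_maximalFun _
  have hint : ∀ (u : X → ℝ≥0∞), Measurable u → ∀ k,
      ∫⁻ x, (maximalFun μ n)^[k] u x ^ e ∂μ ≤ A ^ k * ∫⁻ x, u x ^ e ∂μ := by
    intro u hu k
    induction k with
    | zero => simp
    | succ k ih =>
      rw [Function.iterate_succ_apply']
      calc _ ≤ A' * ∫⁻ x, (maximalFun μ n)^[k] u x ^ e ∂μ := hM _ (hiter u hu k)
        _ ≤ A * (A ^ k * ∫⁻ x, u x ^ e ∂μ) := by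
          gcongr
          exact le_self_add
        _ = _ := by ring
  refine ⟨max (2 * D) (2 ^ e), by
      have : (2 : ℝ≥0∞) ^ e ≠ ∞ := ENNReal.rpow_ne_top_of_nonneg he0.le (by simp)
      exact (max_lt (by finiteness) this.lt_top).ne, ?_, fun u hu => ?_⟩
  · refine le_max_of_le_right ?_
    rw [← ENNReal.one_rpow e]
    gcongr
    norm_num
  have hterm : ∀ k, Measurable fun x => (2⁻¹ : ℝ≥0∞) ^ k * (D⁻¹ ^ k * (maximalFun μ n)^[k] u x) :=
    fun k => ((hiter u hu k).const_mul _).const_mul _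
  refine ⟨fun x => ∑' k, 2⁻¹ ^ k * (D⁻¹ ^ k * (maximalFun μ n)^[k] u x), Measurable.tsum hterm,
    fun x => ?_, fun x => ?_, ?_⟩
  · simpa using ENNReal.le_tsum
      (f := fun k => (2⁻¹ : ℝ≥0∞) ^ k * (D⁻¹ ^ k * (maximalFun μ n)^[k] u x)) 0
  · calc maximalFun μ n (fun x => ∑' k, 2⁻¹ ^ k * (D⁻¹ ^ k * (maximalFun μ n)^[k] u x)) x
        ≤ ∑' k, maximalFun μ n (fun x => 2⁻¹ ^ k * (D⁻¹ ^ k * (maximalFun μ n)^[k] u x)) x :=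
          maximalFun_tsum_le hterm x
      _ ≤ ∑' k, 2 * D * (2⁻¹ ^ (k + 1) * (D⁻¹ ^ (k + 1) * (maximalFun μ n)^[k + 1] u x)) := by
          refine ENNReal.tsum_le_tsum fun k => ?_
          refine (maximalFun_const_mul_le (by finiteness) _ x).trans ?_
          calc (2⁻¹ : ℝ≥0∞) ^ k * maximalFun μ n (fun x => D⁻¹ ^ k * (maximalFun μ n)^[k] u x) x
              ≤ 2⁻¹ ^ k * (D⁻¹ ^ k * maximalFun μ n ((maximalFun μ n)^[k] u) x) := by
                gcongr
                exact maximalFun_const_mul_le (by finiteness) _ x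
            _ = (2 * 2⁻¹) * (D * D⁻¹) *
                  (2⁻¹ ^ k * (D⁻¹ ^ k * maximalFun μ n ((maximalFun μ n)^[k] u) x)) := by
                rw [ENNReal.mul_inv_cancel (by simp) (by simp), ENNReal.mul_inv_cancel hD0 hD1]
                simp
            _ = _ := by
                rw [Function.iterate_succ_apply']
                ring
      _ = 2 * D * ∑' k, 2⁻¹ ^ (k + 1) * (D⁻¹ ^ (k + 1) * (maximalFun μ n)^[k + 1] u x) :=
          ENNReal.tsum_mul_left
      _ ≤ _ := by
          gcongr ?_ * ?_
          · exact le_max_left _ _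
          · exact ENNReal.tsum_comp_le_tsum_of_injective (add_left_injective 1)
              (fun k => (2⁻¹ : ℝ≥0∞) ^ k * (D⁻¹ ^ k * (maximalFun μ n)^[k] u x))
  · have h2 : ∑' k : ℕ, (2⁻¹ : ℝ≥0∞) ^ k = 2 := by
      rw [ENNReal.tsum_geometric, ENNReal.one_sub_inv_two, inv_inv]
    calc ∫⁻ x, (∑' k, 2⁻¹ ^ k * (D⁻¹ ^ k * (maximalFun μ n)^[k] u x)) ^ e ∂μ
        ≤ ∫⁻ x, 2 ^ (e - 1) * ∑' k, 2⁻¹ ^ k * (D⁻¹ ^ k * (maximalFun μ n)^[k] u x) ^ e ∂μ := by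
          refine lintegral_mono fun x => ?_
          have := tsum_mul_rpow_le he.le (fun k => (2⁻¹ : ℝ≥0∞) ^ k)
            (fun k => D⁻¹ ^ k * (maximalFun μ n)^[k] u x)
          rwa [h2] at this
      _ = 2 ^ (e - 1) * ∑' k, 2⁻¹ ^ k * ∫⁻ x, (D⁻¹ ^ k * (maximalFun μ n)^[k] u x) ^ e ∂μ := by
          have hm : ∀ k, Measurable fun x => (D⁻¹ ^ k * (maximalFun μ n)^[k] u x) ^ e := fun k =>
            ((hiter u hu k).const_mul _).pow_const e
          rw [lintegral_const_mul _ (Measurable.tsum fun k => (hm k).const_mul _),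
            lintegral_tsum fun k => ((hm k).const_mul _).aemeasurable]
          congr 2
          ext k
          rw [lintegral_const_mul _ (hm k)]
      _ ≤ 2 ^ (e - 1) * ∑' k, 2⁻¹ ^ k * ∫⁻ x, u x ^ e ∂μ := by
          gcongr 2 ^ (e - 1) * ?_
          refine ENNReal.tsum_le_tsum fun k => ?_
          gcongr 2⁻¹ ^ k * ?_
          calc ∫⁻ x, (D⁻¹ ^ k * (maximalFun μ n)^[k] u x) ^ e ∂μ
              = A⁻¹ ^ k * ∫⁻ x, (maximalFun μ n)^[k] u x ^ e ∂μ := by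
                rw [← lintegral_const_mul _ ((hiter u hu k).pow_const e)]
                refine lintegral_congr fun x => ?_
                rw [ENNReal.mul_rpow_of_nonneg _ _ he0.le, ← ENNReal.rpow_natCast,
                  ← ENNReal.rpow_mul, mul_comm (k : ℝ), ENNReal.rpow_mul, ENNReal.inv_rpow, hDe,
                  ENNReal.rpow_natCast]
            _ ≤ A⁻¹ ^ k * (A ^ k * ∫⁻ x, u x ^ e ∂μ) := by
                gcongr
                exact hint u hu k
            _ = ∫⁻ x, u x ^ e ∂μ := by
                rw [← mul_assoc, ← mul_pow, ENNReal.inv_mul_cancel hA0 hA1, one_pow, one_mul]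
      _ = 2 ^ e * ∫⁻ x, u x ^ e ∂μ := by
          rw [ENNReal.tsum_mul_right, h2, ← mul_assoc]
          congr 1
          nth_rewrite 2 [← ENNReal.rpow_one 2]
          rw [← ENNReal.rpow_add _ _ (by simp) (by simp)]
          congr 1
          ring
      _ ≤ _ := by
          gcongr
          exact le_max_right _ _

theorem lintegral_ballAvg_le [SecondCountableTopology X] {g : X → ℝ≥0∞} (hg : Measurable g)
    {r : ℝ} (hr : 0 < r) :
    ∫⁻ x, ballAvg μ n r g x ∂μ ≤ C * ∫⁻ x, g x ∂μ := by
  have := h.sigmaFinite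
  have key := lintegral_ballAvg_mul (μ := μ) (n := n) hg (measurable_const (a := (1 : ℝ≥0∞))) r
  simp only [mul_one] at key
  rw [key, ← lintegral_const_mul _ hg]
  refine lintegral_mono fun x => ?_
  rw [mul_comm]
  gcongr
  simpa using h.ballAvg_const_le 1 hr x

theorem le_lintegral_ballAvg [SecondCountableTopology X] {g : X → ℝ≥0∞} (hg : Measurable g)
    {r : ℝ} (hr : 0 < r) :
    c * ∫⁻ x, g x ∂μ ≤ ∫⁻ x, ballAvg μ n r g x ∂μ := by
  have := h.sigmaFinite
  have key := lintegral_ballAvg_mul (μ := μ) (n := n) hg (measurable_const (a := (1 : ℝ≥0∞))) r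
  simp only [mul_one] at key
  rw [key, ← lintegral_const_mul _ hg]
  refine lintegral_mono fun x => ?_
  rw [mul_comm]
  gcongr
  rw [ballAvg, setLIntegral_one, ← ENNReal.div_eq_inv_mul,
    ENNReal.le_div_iff_mul_le (Or.inl (h.ballVol_ne_zero hr)) (Or.inl (h.ballVol_ne_top r))]
  exact h.lower x r hr

/-- A weight `u ^ (1 / r)` with `u ∈ A₁` is admissible: the average of `u` is dominated by `u`,
and the averages of `g ^ s` can be moved onto the weight by symmetry. -/
theorem admissibleWeight_rpow [SecondCountableTopology X] {s r : ℝ} (hs : 1 ≤ s) (hs2 : s < 2)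
    (hr : 1 ≤ r) {K : ℝ≥0∞} (hK : K ≠ ∞) :
    ∃ L : ℝ≥0∞, L ≠ ∞ ∧ ∀ u : X → ℝ≥0∞, Measurable u → (∀ x, maximalFun μ n u x ≤ K * u x) →
      AdmissibleWeight μ n s r (fun x => u x ^ (1 / r)) L := by
  have := h.sigmaFinite
  have hr0 : 0 < r := by linarith
  have hs0 : 0 < s := by linarith
  have h2s : 1 ≤ 2 / s := by rw [le_div_iff₀ hs0]; linarith
  set L1 : ℝ≥0∞ := (C : ℝ≥0∞) ^ (2 / s - 1) with hL1
  set L2 : ℝ≥0∞ := K ^ (1 / r) with hL2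
  set L3 : ℝ≥0∞ := ((C : ℝ≥0∞) ^ (r - 1) * K) ^ (1 / r) with hL3
  have hL1t : L1 ≠ ∞ := ENNReal.rpow_ne_top_of_nonneg (by linarith) (by simp)
  have hL2t : L2 ≠ ∞ := ENNReal.rpow_ne_top_of_nonneg (by positivity) hK
  have hL3t : L3 ≠ ∞ := ENNReal.rpow_ne_top_of_nonneg (by positivity)
    (ENNReal.mul_ne_top (ENNReal.rpow_ne_top_of_nonneg (by linarith) (by simp)) hK)
  refine ⟨L1 * L2 * L3, by finiteness, fun u hu hMu t R ht htR g hg => ?_⟩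
  have hR : 0 < R := ht.trans_le htR
  have hpow : ∀ y, (u y ^ (1 / r)) ^ r = u y := fun y => by
    rw [← ENNReal.rpow_mul, one_div_mul_cancel hr0.ne', ENNReal.rpow_one]
  have hgs : ∀ y, (g y ^ s) ^ (2 / s) = g y ^ (2 : ℝ) := fun y => by
    rw [← ENNReal.rpow_mul, mul_div_cancel₀ _ hs0.ne']
  have hw : Measurable fun x => u x ^ (1 / r) := hu.pow_const _
  have hg2 : Measurable fun x => g x ^ (2 : ℝ) := hg.pow_const _
  have havg : ∀ x, ballAvg μ n R (fun y => u y ^ (1 / r)) x ≤ L3 * u x ^ (1 / r) := by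
    intro x
    rw [← ENNReal.mul_rpow_of_nonneg _ _ (by positivity), mul_assoc]
    rw [one_div, ENNReal.le_rpow_inv_iff hr0]
    refine (h.ballAvg_rpow_le hr (by simpa [one_div] using hw) hR x).trans ?_
    gcongr
    simp only [← one_div, hpow]
    exact (ballAvg_le_maximalFun u hR x).trans (hMu x)
  calc ∫⁻ x, ballAvg μ n R (fun y => g y ^ s) x ^ (2 / s)
        * ballAvg μ n t (fun y => (u y ^ (1 / r)) ^ r) x ^ (1 / r) ∂μ
      ≤ ∫⁻ x, L1 * L2 * (ballAvg μ n R (fun y => g y ^ (2 : ℝ)) x * u x ^ (1 / r)) ∂μ := by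
        refine lintegral_mono fun x => ?_
        calc ballAvg μ n R (fun y => g y ^ s) x ^ (2 / s)
            * ballAvg μ n t (fun y => (u y ^ (1 / r)) ^ r) x ^ (1 / r)
            ≤ (L1 * ballAvg μ n R (fun y => g y ^ (2 : ℝ)) x) * (K * u x) ^ (1 / r) := by
              gcongr
              · simpa only [hgs] using h.ballAvg_rpow_le h2s (hg.pow_const s) hR x
              · simp only [hpow]
                exact (ballAvg_le_maximalFun u ht x).trans (hMu x)
          _ = _ := by
              rw [ENNReal.mul_rpow_of_nonneg _ _ (by positivity)]
              ring
    _ = L1 * L2 * ∫⁻ x, g x ^ (2 : ℝ) * ballAvg μ n R (fun y => u y ^ (1 / r)) x ∂μ := by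
        rw [lintegral_const_mul _ ((measurable_ballAvg _ _).fun_mul hw),
          lintegral_ballAvg_mul hg2 hw]
    _ ≤ L1 * L2 * ∫⁻ x, L3 * (g x ^ (2 : ℝ) * u x ^ (1 / r)) ∂μ := by
        gcongr L1 * L2 * ?_
        refine lintegral_mono fun x => ?_
        calc _ ≤ g x ^ (2 : ℝ) * (L3 * u x ^ (1 / r)) := by gcongr; exact havg x
          _ = _ := by ring
    _ = _ := by
        rw [lintegral_const_mul _ (hg2.fun_mul hw)]
        ring

/-- A weight `u ^ (-b)` with `u ∈ A₁` and small `b` is admissible. On a ball it is at most a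
constant times the power `-b` of the average of `u`, and Hölder's inequality produces the power `b`
of the same average, so that the two cancel. -/
theorem admissibleWeight_rpow_neg [SecondCountableTopology X] {s r b : ℝ} (hs : 1 ≤ s)
    (hs2 : s < 2) (hr : 1 ≤ r) (hb : 0 < b) (hb2 : b ≤ (2 - s) / s) {K : ℝ≥0∞} (hK : K ≠ ∞)
    (hK1 : 1 ≤ K) :
    ∃ L : ℝ≥0∞, L ≠ ∞ ∧ ∀ u : X → ℝ≥0∞, Measurable u → (∀ x, maximalFun μ n u x ≤ K * u x) →
      (∀ x, u x ≠ 0) → (∀ᵐ x ∂μ, u x ≠ ∞) →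
      AdmissibleWeight μ n s r (fun x => u x ^ (-b)) L := by
  have := h.sigmaFinite
  have hr0 : 0 < r := by linarith
  have hs0 : 0 < s := by linarith
  have hs2' : 0 < 2 - s := by linarith
  set θ : ℝ := b * s / (2 - s) with hθ
  have hθ0 : 0 < θ := by positivity
  have hθ1 : θ ≤ 1 := by
    rw [hθ, div_le_one hs2']
    rwa [le_div_iff₀ hs0] at hb2
  set K' : ℝ≥0∞ := ENNReal.ofReal 2 ^ n * K with hK'
  have hK't : K' ≠ ∞ :=
    ENNReal.mul_ne_top (ENNReal.rpow_ne_top_of_nonneg h.dim_pos.le (by simp)) hK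
  have hK'0 : K' ≠ 0 := mul_ne_zero (ENNReal.rpow_pos (by simp) (by simp)).ne'
    (one_pos.trans_le hK1).ne'
  set L1 : ℝ≥0∞ := ((C : ℝ≥0∞) ^ (1 / θ - 1)) ^ b with hL1
  set L2 : ℝ≥0∞ := (C : ℝ≥0∞) ^ (1 / r) * K' ^ b with hL2
  clear_value K'
  have hθ' : 1 ≤ 1 / θ := by rw [le_div_iff₀ hθ0]; linarith
  have hL1t : L1 ≠ ∞ := ENNReal.rpow_ne_top_of_nonneg hb.le
    (ENNReal.rpow_ne_top_of_nonneg (by linarith) (by simp))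
  have hL2t : L2 ≠ ∞ := ENNReal.mul_ne_top (ENNReal.rpow_ne_top_of_nonneg (by positivity) (by simp))
    (ENNReal.rpow_ne_top_of_nonneg hb.le hK't)
  refine ⟨L1 * L2 * C, by finiteness, fun u hu hMu hu0 hu1 t R ht htR g hg => ?_⟩
  have hR : 0 < R := ht.trans_le htR
  have hw : Measurable fun x => u x ^ (-b) := hu.pow_const _
  have hg2 : Measurable fun x => g x ^ (2 : ℝ) := hg.pow_const _
  -- the lower bound for `u` on balls that is behind `A₁`
  have hlow : ∀ x, ∀ y ∈ Metric.ball x R, ballAvg μ n R u x ≤ K' * u y := by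
    intro x y hy
    have hsub : Metric.ball x R ⊆ Metric.ball y (2 * R) := by
      refine Metric.ball_subset_ball' ?_
      rw [Metric.mem_ball, dist_comm] at hy
      linarith
    calc ballAvg μ n R u x ≤ ENNReal.ofReal 2 ^ n * ballAvg μ n (2 * R) u y :=
          h.ballAvg_le_of_subset (by norm_num) hsub
      _ ≤ ENNReal.ofReal 2 ^ n * (K * u y) := by
          gcongr
          exact (ballAvg_le_maximalFun u (by positivity) y).trans (hMu y)
      _ = K' * u y := by rw [hK', mul_assoc]
  have hweight : ∀ x, ballAvg μ n t (fun y => (u y ^ (-b)) ^ r) x ^ (1 / r)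
      ≤ L2 * (ballAvg μ n R u x ^ b)⁻¹ := by
    intro x
    set Q := ballAvg μ n R u x
    have hpt : ∀ y ∈ Metric.ball x t, (u y ^ (-b)) ^ r ≤ (K' ^ b * (Q ^ b)⁻¹) ^ r := by
      intro y hy
      gcongr
      have h1 : (K' * u y) ^ (-b) ≤ Q ^ (-b) := by
        rw [ENNReal.rpow_neg, ENNReal.rpow_neg]
        gcongr
        exact hlow x y (Metric.ball_subset_ball htR hy)
      calc u y ^ (-b) = K' ^ b * (K' ^ b * u y ^ b)⁻¹ := by
            rw [ENNReal.mul_inv (Or.inl (ENNReal.rpow_pos (pos_iff_ne_zero.2 hK'0) hK't).ne')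
              (Or.inl (ENNReal.rpow_ne_top_of_nonneg hb.le hK't)), ← mul_assoc,
              ENNReal.mul_inv_cancel (ENNReal.rpow_pos (pos_iff_ne_zero.2 hK'0) hK't).ne'
                (ENNReal.rpow_ne_top_of_nonneg hb.le hK't), one_mul, ENNReal.rpow_neg]
        _ = K' ^ b * (K' * u y) ^ (-b) := by
            rw [ENNReal.rpow_neg, ENNReal.mul_rpow_of_nonneg _ _ hb.le]
        _ ≤ _ := by
            rw [← ENNReal.rpow_neg Q]
            gcongr
    calc ballAvg μ n t (fun y => (u y ^ (-b)) ^ r) x ^ (1 / r)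
        ≤ (C * (K' ^ b * (Q ^ b)⁻¹) ^ r) ^ (1 / r) := by
          gcongr
          exact (ballAvg_mono hpt).trans (h.ballAvg_const_le _ ht x)
      _ = _ := by
          rw [ENNReal.mul_rpow_of_nonneg _ _ (by positivity), ← ENNReal.rpow_mul,
            mul_one_div_cancel hr0.ne', ENNReal.rpow_one, hL2, mul_assoc]
  have hholder : ∀ x, ballAvg μ n R (fun y => g y ^ s) x ^ (2 / s)
      ≤ ballAvg μ n R (fun y => g y ^ (2 : ℝ) * u y ^ (-b)) x * (L1 * ballAvg μ n R u x ^ b) := by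
    intro x
    have hconj : (2 / s).HolderConjugate (2 / (2 - s)) := by
      rw [Real.holderConjugate_iff]
      refine ⟨by rw [lt_div_iff₀ hs0]; linarith, by field_simp; ring⟩
    have h1 : ballAvg μ n R (fun y => g y ^ s) x
        ≤ ballAvg μ n R
            (fun y => (g y ^ (2 : ℝ) * u y ^ (-b)) ^ (s / 2) * u y ^ (b * s / 2)) x := by
      refine ballAvg_mono_ae ?_
      filter_upwards [hu1] with y hy
      rw [ENNReal.mul_rpow_of_nonneg _ _ (by positivity), ← ENNReal.rpow_mul, ← ENNReal.rpow_mul,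
        mul_assoc, ← ENNReal.rpow_add _ _ (hu0 y) hy]
      rw [show -b * (s / 2) + b * s / 2 = 0 by ring, show (2 : ℝ) * (s / 2) = s by ring]
      simp
    have h2 : ballAvg μ n R (fun y => (g y ^ (2 : ℝ) * u y ^ (-b)) ^ (s / 2) * u y ^ (b * s / 2)) x
        ≤ ballAvg μ n R (fun y => g y ^ (2 : ℝ) * u y ^ (-b)) x ^ (s / 2) *
          ballAvg μ n R (fun y => u y ^ θ) x ^ ((2 - s) / 2) := by
      simp only [ballAvg_eq_lintegral]
      have := ENNReal.lintegral_mul_le_Lp_mul_Lq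
        ((ballVol X n R)⁻¹ • μ.restrict (Metric.ball x R)) hconj
        (f := fun y => (g y ^ (2 : ℝ) * u y ^ (-b)) ^ (s / 2)) (g := fun y => u y ^ (b * s / 2))
        ((hg2.fun_mul hw).pow_const _).aemeasurable (hu.pow_const _).aemeasurable
      simp only [Pi.mul_apply, ← ENNReal.rpow_mul, one_div_div] at this
      rw [show s / 2 * (2 / s) = 1 by field_simp,
        show b * s / 2 * (2 / (2 - s)) = θ by rw [hθ]; field_simp] at this
      simpa only [ENNReal.rpow_one] using this
    have h3 : ballAvg μ n R (fun y => u y ^ θ) x ^ (1 / θ) ≤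
        (C : ℝ≥0∞) ^ (1 / θ - 1) * ballAvg μ n R u x := by
      have := h.ballAvg_rpow_le hθ' (hu.pow_const θ) hR x
      simpa only [← ENNReal.rpow_mul, mul_one_div_cancel hθ0.ne', ENNReal.rpow_one] using this
    calc ballAvg μ n R (fun y => g y ^ s) x ^ (2 / s)
        ≤ (ballAvg μ n R (fun y => g y ^ (2 : ℝ) * u y ^ (-b)) x ^ (s / 2) *
          ballAvg μ n R (fun y => u y ^ θ) x ^ ((2 - s) / 2)) ^ (2 / s) := by
          gcongr
          exact h1.trans h2
      _ = ballAvg μ n R (fun y => g y ^ (2 : ℝ) * u y ^ (-b)) x *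
          (ballAvg μ n R (fun y => u y ^ θ) x ^ (1 / θ)) ^ b := by
          rw [ENNReal.mul_rpow_of_nonneg _ _ (by positivity), ← ENNReal.rpow_mul,
            ← ENNReal.rpow_mul, ← ENNReal.rpow_mul, show s / 2 * (2 / s) = 1 by field_simp,
            show (2 - s) / 2 * (2 / s) = 1 / θ * b by rw [hθ]; field_simp, ENNReal.rpow_one]
      _ ≤ ballAvg μ n R (fun y => g y ^ (2 : ℝ) * u y ^ (-b)) x *
          ((C : ℝ≥0∞) ^ (1 / θ - 1) * ballAvg μ n R u x) ^ b := by gcongr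
      _ = _ := by rw [ENNReal.mul_rpow_of_nonneg _ _ hb.le]
  calc ∫⁻ x, ballAvg μ n R (fun y => g y ^ s) x ^ (2 / s)
        * ballAvg μ n t (fun y => (u y ^ (-b)) ^ r) x ^ (1 / r) ∂μ
      ≤ ∫⁻ x, L1 * L2 * ballAvg μ n R (fun y => g y ^ (2 : ℝ) * u y ^ (-b)) x ∂μ := by
        refine lintegral_mono fun x => ?_
        set Q := ballAvg μ n R u x with hQ
        calc _ ≤ (ballAvg μ n R (fun y => g y ^ (2 : ℝ) * u y ^ (-b)) x * (L1 * Q ^ b)) *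
              (L2 * (Q ^ b)⁻¹) := by
              gcongr
              · exact hholder x
              · exact hweight x
          _ = L1 * L2 * ballAvg μ n R (fun y => g y ^ (2 : ℝ) * u y ^ (-b)) x *
              (Q ^ b * (Q ^ b)⁻¹) := by ring
          -- this holds also if `Q` is `0` or `∞`, where `Q ^ b * (Q ^ b)⁻¹ = 0`
          _ ≤ _ := mul_le_of_le_one_right' (ENNReal.mul_inv_le_one _)
    _ = L1 * L2 * ∫⁻ x, ballAvg μ n R (fun y => g y ^ (2 : ℝ) * u y ^ (-b)) x ∂μ :=
        lintegral_const_mul _ (measurable_ballAvg _ _)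
    _ ≤ L1 * L2 * (C * ∫⁻ x, g x ^ (2 : ℝ) * u x ^ (-b) ∂μ) := by
        gcongr
        exact h.lintegral_ballAvg_le (hg2.fun_mul hw) hR
    _ = _ := by ring

end RegularWith

/-! ### Weighted estimates and extrapolation -/

namespace RegularWith

variable {X : Type*} [MetricSpace X] [MeasurableSpace X] [BorelSpace X] {μ : Measure X} {n : ℝ}
  {c C : ℝ≥0} (h : RegularWith μ n c C)
include h

/-- A function whose local `L^q` averages at scale `t` are dominated by a geometrically weighted
sum of the `L^s` averages of `G` at the scales `2 ^ (k + 1) t` is dominated by `G` in `L²(w)`, for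
every admissible weight `w`. The constant depends on neither the scale nor the weight. -/
theorem exists_lintegral_sq_mul_weight_le [SecondCountableTopology X] {s q : ℝ} (hs : 1 ≤ s)
    (hq : 2 < q) {K a : ℝ≥0∞} (hK : K ≠ ∞) (ha : a < 1) :
    ∃ K' : ℝ≥0∞, K' ≠ ∞ ∧ ∀ (w : X → ℝ≥0∞) (L : ℝ≥0∞), Measurable w →
      AdmissibleWeight μ n s (q / (q - 2)) w L →
      ∀ (t : ℝ) (F G : X → ℝ≥0∞), 0 < t → Measurable F → Measurable G →
      (∀ x, ballAvg μ n t (fun y => F y ^ q) x ^ (1 / q)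
        ≤ K * ∑' k : ℕ, a ^ k * ballAvg μ n (2 ^ (k + 1) * t) (fun y => G y ^ s) x ^ (1 / s)) →
      ∫⁻ x, F x ^ (2 : ℝ) * w x ∂μ ≤ K' * L * ∫⁻ x, G x ^ (2 : ℝ) * w x ∂μ := by
  have := h.sigmaFinite
  have hq0 : 0 < q := by linarith
  have hs0 : 0 < s := by linarith
  have hq2 : 0 < q - 2 := by linarith
  have hc0 : (c : ℝ≥0∞) ≠ 0 := by exact_mod_cast h.const_pos.ne'
  set r := q / (q - 2) with hr
  have hconj : (q / 2).HolderConjugate r := by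
    rw [Real.holderConjugate_iff]
    refine ⟨by rw [lt_div_iff₀ (by norm_num)]; linarith, by rw [hr]; field_simp; ring⟩
  set S : ℝ≥0∞ := ∑' k : ℕ, a ^ k with hS
  have hSt : S ≠ ∞ := by
    rw [hS, ENNReal.tsum_geometric]
    exact ENNReal.inv_ne_top.2 (tsub_pos_of_lt ha).ne'
  have hK2 : K ^ (2 : ℝ) ≠ ∞ := ENNReal.rpow_ne_top_of_nonneg (by norm_num) hK
  refine ⟨(c : ℝ≥0∞)⁻¹ * (K ^ (2 : ℝ) * S * S), ?_, fun w L hw hadm t F G ht hF hG hloc => ?_⟩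
  · have : (c : ℝ≥0∞)⁻¹ ≠ ∞ := ENNReal.inv_ne_top.2 hc0
    finiteness
  have hF2 : Measurable fun x => F x ^ (2 : ℝ) := hF.pow_const _
  have hpt : ∀ x, ballAvg μ n t (fun y => F y ^ (2 : ℝ) * w y) x
      ≤ K ^ (2 : ℝ) * S * ∑' k : ℕ, a ^ k *
        (ballAvg μ n (2 ^ (k + 1) * t) (fun y => G y ^ s) x ^ (2 / s)
          * ballAvg μ n t (fun y => w y ^ r) x ^ (1 / r)) := by
    intro x
    have hhold : ballAvg μ n t (fun y => F y ^ (2 : ℝ) * w y) x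
        ≤ (ballAvg μ n t (fun y => F y ^ q) x ^ (1 / q)) ^ (2 : ℝ)
          * ballAvg μ n t (fun y => w y ^ r) x ^ (1 / r) := by
      simp only [ballAvg_eq_lintegral]
      have := ENNReal.lintegral_mul_le_Lp_mul_Lq
        ((ballVol X n t)⁻¹ • μ.restrict (Metric.ball x t)) hconj
        (f := fun y => F y ^ (2 : ℝ)) (g := w) hF2.aemeasurable hw.aemeasurable
      simp only [Pi.mul_apply, ← ENNReal.rpow_mul] at this
      rw [mul_div_cancel₀ _ (two_ne_zero' ℝ), one_div_div] at this
      rwa [← ENNReal.rpow_mul, div_mul_eq_mul_div, one_mul]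
    have hser : (ballAvg μ n t (fun y => F y ^ q) x ^ (1 / q)) ^ (2 : ℝ)
        ≤ K ^ (2 : ℝ) * (S * ∑' k : ℕ, a ^ k *
          ballAvg μ n (2 ^ (k + 1) * t) (fun y => G y ^ s) x ^ (2 / s)) := by
      calc _ ≤ (K * ∑' k : ℕ, a ^ k *
              ballAvg μ n (2 ^ (k + 1) * t) (fun y => G y ^ s) x ^ (1 / s)) ^ (2 : ℝ) := by
            gcongr
            exact hloc x
        _ ≤ _ := by
            rw [ENNReal.mul_rpow_of_nonneg _ _ (by norm_num)]
            gcongr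
            have := tsum_mul_rpow_le (one_le_two (α := ℝ)) (fun k => a ^ k) (fun k =>
              ballAvg μ n (2 ^ (k + 1) * t) (fun y => G y ^ s) x ^ (1 / s))
            simp only [← ENNReal.rpow_mul, div_mul_eq_mul_div, one_mul] at this
            rwa [show (2 : ℝ) - 1 = 1 by norm_num, ENNReal.rpow_one] at this
    calc _ ≤ K ^ (2 : ℝ) * (S * ∑' k : ℕ, a ^ k *
          ballAvg μ n (2 ^ (k + 1) * t) (fun y => G y ^ s) x ^ (2 / s))
          * ballAvg μ n t (fun y => w y ^ r) x ^ (1 / r) := hhold.trans (by gcongr)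
      _ = K ^ (2 : ℝ) * S * ((∑' k : ℕ, a ^ k *
          ballAvg μ n (2 ^ (k + 1) * t) (fun y => G y ^ s) x ^ (2 / s))
          * ballAvg μ n t (fun y => w y ^ r) x ^ (1 / r)) := by ring
      _ = _ := by
          rw [← ENNReal.tsum_mul_right]
          simp only [mul_assoc]
  have hm : ∀ k : ℕ, Measurable fun x =>
      ballAvg μ n (2 ^ (k + 1) * t) (fun y => G y ^ s) x ^ (2 / s)
          * ballAvg μ n t (fun y => w y ^ r) x ^ (1 / r) := fun k =>
    ((measurable_ballAvg _ _).pow_const _).mul ((measurable_ballAvg _ _).pow_const _)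
  calc ∫⁻ x, F x ^ (2 : ℝ) * w x ∂μ
      = (c : ℝ≥0∞)⁻¹ * (c * ∫⁻ x, F x ^ (2 : ℝ) * w x ∂μ) := by
        rw [← mul_assoc, ENNReal.inv_mul_cancel hc0 (by simp), one_mul]
    _ ≤ (c : ℝ≥0∞)⁻¹ * ∫⁻ x, ballAvg μ n t (fun y => F y ^ (2 : ℝ) * w y) x ∂μ := by
        gcongr
        exact h.le_lintegral_ballAvg (hF2.fun_mul hw) ht
    _ ≤ (c : ℝ≥0∞)⁻¹ * ∫⁻ x, K ^ (2 : ℝ) * S * ∑' k : ℕ, a ^ k *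
        (ballAvg μ n (2 ^ (k + 1) * t) (fun y => G y ^ s) x ^ (2 / s)
          * ballAvg μ n t (fun y => w y ^ r) x ^ (1 / r)) ∂μ := by
        gcongr with x
        exact hpt x
    _ = (c : ℝ≥0∞)⁻¹ * (K ^ (2 : ℝ) * S * ∑' k : ℕ, a ^ k *
        ∫⁻ x, ballAvg μ n (2 ^ (k + 1) * t) (fun y => G y ^ s) x ^ (2 / s)
          * ballAvg μ n t (fun y => w y ^ r) x ^ (1 / r) ∂μ) := by
        rw [lintegral_const_mul _ (Measurable.tsum fun k => (hm k).const_mul _),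
          lintegral_tsum fun k => ((hm k).const_mul _).aemeasurable]
        congr 3
        ext k
        rw [lintegral_const_mul _ (hm k)]
    _ ≤ (c : ℝ≥0∞)⁻¹ * (K ^ (2 : ℝ) * S * ∑' k : ℕ, a ^ k *
        (L * ∫⁻ x, G x ^ (2 : ℝ) * w x ∂μ)) := by
        gcongr (c : ℝ≥0∞)⁻¹ * (K ^ (2 : ℝ) * S * ?_)
        refine ENNReal.tsum_le_tsum fun k => ?_
        gcongr
        refine hadm t _ ht ?_ G hG
        exact le_mul_of_one_le_left ht.le (one_le_pow₀ (by norm_num))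
    _ = _ := by
        rw [ENNReal.tsum_mul_right]
        ring

/-- Extrapolation with limited range: a bound in `L²(w)` for all admissible weights `w` gives a
bound in `L^p` for `s < p < q`. -/
theorem exists_lintegral_rpow_le_of_admissibleWeight [SecondCountableTopology X] {s p q : ℝ}
    (hs : 1 ≤ s) (hs2 : s < 2) (hq : 2 < q) (hsp : s < p) (hpq : p < q) {K : ℝ≥0∞} (hK : K ≠ ∞) :
    ∃ K' : ℝ≥0∞, K' ≠ ∞ ∧ ∀ F G : X → ℝ≥0∞, Measurable F → Measurable G →
      ∫⁻ x, F x ^ (2 : ℝ) ∂μ ≠ ∞ →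
      (∀ (w : X → ℝ≥0∞) (L : ℝ≥0∞), Measurable w → AdmissibleWeight μ n s (q / (q - 2)) w L →
        ∫⁻ x, F x ^ (2 : ℝ) * w x ∂μ ≤ K * L * ∫⁻ x, G x ^ (2 : ℝ) * w x ∂μ) →
      ∫⁻ x, F x ^ p ∂μ ≤ K' * ∫⁻ x, G x ^ p ∂μ := by
  have hq2 : 0 < q - 2 := by linarith
  have hs0 : 0 < s := by linarith
  have hp0 : 0 < p := by linarith
  set r := q / (q - 2) with hr
  have hr0 : 0 < r := by positivity
  have hr1 : 1 ≤ r := by rw [hr, le_div_iff₀ hq2]; linarith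
  -- the constant weight is admissible
  obtain ⟨L₁, hL₁, hadm₁⟩ := h.admissibleWeight_rpow hs hs2 hr1 (K := C) (by simp)
  have hone : ∀ F G : X → ℝ≥0∞,
      (∀ (w : X → ℝ≥0∞) (L : ℝ≥0∞), Measurable w → AdmissibleWeight μ n s r w L →
        ∫⁻ x, F x ^ (2 : ℝ) * w x ∂μ ≤ K * L * ∫⁻ x, G x ^ (2 : ℝ) * w x ∂μ) →
      ∫⁻ x, F x ^ (2 : ℝ) ∂μ ≤ K * L₁ * ∫⁻ x, G x ^ (2 : ℝ) ∂μ := by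
    intro F G hw
    have := hw _ L₁ (measurable_const.pow_const _) (hadm₁ (fun _ => 1) measurable_const
      (fun x => iSup₂_le fun r hr => h.ballAvg_const_le 1 hr x))
    simpa using this
  rcases lt_trichotomy p 2 with hp2 | rfl | hp2
  · -- `p < 2`: a negative power of an `A₁` majorant of `G ^ s` as weight, and Hölder's inequality
    have hps : 1 < p / s := by rwa [one_lt_div hs0]
    obtain ⟨M, hM, hM1, hmaj⟩ := h.exists_maximalFun_le_majorant hps
    have hb : 0 < (2 - p) / s := div_pos (by linarith) hs0
    set b := (2 - p) / s with hb'
    obtain ⟨L, hL, hadm⟩ := h.admissibleWeight_rpow_neg hs hs2 hr1 hb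
      (by rw [hb']; gcongr) hM hM1
    refine ⟨(K * L) ^ (p / 2) * M ^ ((2 - p) / 2) + 1, ?_, fun F G hF hG _ hw => ?_⟩
    · have h1 : (K * L) ^ (p / 2) ≠ ∞ :=
        ENNReal.rpow_ne_top_of_nonneg (by positivity) (ENNReal.mul_ne_top hK hL)
      have h2 : M ^ ((2 - p) / 2) ≠ ∞ := ENNReal.rpow_ne_top_of_nonneg (by linarith) hM
      finiteness
    rcases eq_or_ne (∫⁻ x, G x ^ p ∂μ) ∞ with htop | htop
    · rw [htop, ENNReal.mul_top (by positivity)]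
      exact le_top
    rcases eq_or_ne (∫⁻ x, G x ^ p ∂μ) 0 with hzero | hzero
    · -- here the majorant may vanish, and the weight is useless
      have hG0 : ∀ᵐ x ∂μ, G x = 0 := by
        filter_upwards [(lintegral_eq_zero_iff (hG.pow_const p)).1 hzero] with x hx
        exact (ENNReal.rpow_eq_zero_iff_of_pos hp0).1 hx
      have hF2 : ∫⁻ x, F x ^ (2 : ℝ) ∂μ = 0 := by
        refine le_antisymm ((hone F G hw).trans ?_) zero_le
        rw [lintegral_congr_ae (g := fun _ => 0)]
        · simp
        · filter_upwards [hG0] with x hx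
          simp [hx]
      refine le_of_eq_of_le ?_ zero_le
      rw [lintegral_eq_zero_iff (hF.pow_const p)]
      filter_upwards [(lintegral_eq_zero_iff (hF.pow_const 2)).1 hF2] with x hx
      have : F x = 0 := (ENNReal.rpow_eq_zero_iff_of_pos two_pos).1 hx
      simp [this, hp0]
    obtain ⟨u, hu, hGu, hMu, hint⟩ := hmaj (fun x => G x ^ s) (hG.pow_const s)
    have hGs : ∀ x, (G x ^ s) ^ (p / s) = G x ^ p := fun x => by
      rw [← ENNReal.rpow_mul, mul_div_cancel₀ _ hs0.ne']
    simp only [hGs] at hint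
    have hu1 : ∀ᵐ x ∂μ, u x ≠ ∞ := by
      have := ae_lt_top (hu.pow_const (p / s)) (hint.trans_lt (ENNReal.mul_lt_top hM.lt_top
        htop.lt_top)).ne
      filter_upwards [this] with x hx hux
      rw [hux, ENNReal.top_rpow_of_pos (by linarith)] at hx
      exact lt_irrefl _ hx
    have hu0 : ∀ x, u x ≠ 0 := by
      intro x hx
      apply hzero
      have hball : ∀ k : ℕ, ∀ᵐ y ∂μ, y ∈ Metric.ball x (k + 1 : ℝ) → u y = 0 := by
        intro k
        have hk : (0 : ℝ) < k + 1 := by positivity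
        have h0 : ballAvg μ n (k + 1) u x = 0 := by
          refine le_antisymm ((ballAvg_le_maximalFun u hk x).trans ((hMu x).trans ?_)) zero_le
          simp [hx]
        rw [ballAvg, mul_eq_zero, ENNReal.inv_eq_zero, or_iff_right (h.ballVol_ne_top _),
          lintegral_eq_zero_iff hu, Filter.EventuallyEq,
          ae_restrict_iff' Metric.isOpen_ball.measurableSet] at h0
        exact h0
      rw [lintegral_eq_zero_iff (hG.pow_const p)]
      filter_upwards [ae_all_iff.2 hball] with y hy
      obtain ⟨k, hk⟩ := exists_nat_gt (dist y x)
      have huy := hy k (by rw [Metric.mem_ball]; linarith)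
      have hGy : G y ^ s = 0 := le_antisymm ((hGu y).trans huy.le) zero_le
      have : G y = 0 := (ENNReal.rpow_eq_zero_iff_of_pos hs0).1 hGy
      simp [this, hp0]
    have hwm : Measurable fun x => u x ^ (-b) := hu.pow_const _
    have hmain := hw _ L hwm (hadm u hu hMu hu0 hu1)
    have hGw : ∫⁻ x, G x ^ (2 : ℝ) * u x ^ (-b) ∂μ ≤ ∫⁻ x, G x ^ p ∂μ := by
      refine lintegral_mono_ae ?_
      filter_upwards [hu1] with x hx
      have hGx : G x ≠ ∞ := by
        intro hGx
        have := hGu x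
        rw [hGx, ENNReal.top_rpow_of_pos hs0] at this
        exact hx (top_le_iff.1 this)
      rcases eq_or_ne (G x) 0 with hG0 | hG0
      · simp [hG0]
      calc G x ^ (2 : ℝ) * u x ^ (-b) ≤ G x ^ (2 : ℝ) * (G x ^ s) ^ (-b) := by
            rw [ENNReal.rpow_neg, ENNReal.rpow_neg]
            gcongr
            exact hGu x
        _ = G x ^ p := by
            rw [← ENNReal.rpow_mul, ← ENNReal.rpow_add _ _ hG0 hGx, hb']
            congr 1
            field_simp
            ring
    have hconj : (2 / p).HolderConjugate (2 / (2 - p)) := by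
      have : 0 < 2 - p := by linarith
      rw [Real.holderConjugate_iff]
      refine ⟨by rw [lt_div_iff₀ hp0]; linarith, by field_simp; ring⟩
    calc ∫⁻ x, F x ^ p ∂μ
        = ∫⁻ x, (F x ^ (2 : ℝ) * u x ^ (-b)) ^ (p / 2) * u x ^ (b * p / 2) ∂μ := by
          refine lintegral_congr_ae ?_
          filter_upwards [hu1] with x hx
          rw [ENNReal.mul_rpow_of_nonneg _ _ (by positivity), ← ENNReal.rpow_mul,
            ← ENNReal.rpow_mul, mul_assoc, ← ENNReal.rpow_add _ _ (hu0 x) hx,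
            show -b * (p / 2) + b * p / 2 = 0 by ring, show (2 : ℝ) * (p / 2) = p by ring]
          simp
      _ ≤ (∫⁻ x, F x ^ (2 : ℝ) * u x ^ (-b) ∂μ) ^ (p / 2)
          * (∫⁻ x, u x ^ (p / s) ∂μ) ^ ((2 - p) / 2) := by
          have := ENNReal.lintegral_mul_le_Lp_mul_Lq μ hconj
            (f := fun x => (F x ^ (2 : ℝ) * u x ^ (-b)) ^ (p / 2)) (g := fun x => u x ^ (b * p / 2))
            (((hF.pow_const _).fun_mul hwm).pow_const _).aemeasurable (hu.pow_const _).aemeasurable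
          simp only [Pi.mul_apply, ← ENNReal.rpow_mul, one_div_div] at this
          have h2p : 2 - p ≠ 0 := by linarith
          rw [show p / 2 * (2 / p) = 1 by field_simp,
            show b * p / 2 * (2 / (2 - p)) = p / s by rw [hb']; field_simp] at this
          simpa only [ENNReal.rpow_one] using this
      _ ≤ (K * L * ∫⁻ x, G x ^ p ∂μ) ^ (p / 2) * (M * ∫⁻ x, G x ^ p ∂μ) ^ ((2 - p) / 2) := by
          gcongr
          · exact hmain.trans (by gcongr)
      _ = (K * L) ^ (p / 2) * M ^ ((2 - p) / 2) * ∫⁻ x, G x ^ p ∂μ := by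
          rw [ENNReal.mul_rpow_of_nonneg _ _ (by positivity),
            ENNReal.mul_rpow_of_nonneg _ _ (by linarith : 0 ≤ (2 - p) / 2)]
          have : ∫⁻ x, G x ^ p ∂μ
              = (∫⁻ x, G x ^ p ∂μ) ^ (p / 2) * (∫⁻ x, G x ^ p ∂μ) ^ ((2 - p) / 2) := by
            rw [← ENNReal.rpow_add _ _ hzero htop, show p / 2 + (2 - p) / 2 = 1 by ring,
              ENNReal.rpow_one]
          conv_rhs => rw [this]
          ring
      _ ≤ _ := by
          gcongr
          exact le_self_add
  · exact ⟨K * L₁, ENNReal.mul_ne_top hK hL₁, fun F G _ _ _ hw => hone F G hw⟩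
  · -- `p > 2`: duality against `g = F ^ (p - 2)`, with `F` truncated to make the integrals finite
    have hp2' : 0 < p - 2 := by linarith
    have he : 1 < p / (p - 2) / r := by
      rw [hr, one_lt_div (by positivity), div_lt_div_iff₀ hq2 hp2']
      nlinarith
    set e := p / (p - 2) / r with he'
    obtain ⟨M, hM, hM1, hmaj⟩ := h.exists_maximalFun_le_majorant he
    obtain ⟨L, hL, hadm⟩ := h.admissibleWeight_rpow hs hs2 hr1 hM
    set B : ℝ≥0∞ := K * L * M ^ ((p - 2) / p) with hB
    have hBt : B ≠ ∞ := ENNReal.mul_ne_top (ENNReal.mul_ne_top hK hL)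
      (ENNReal.rpow_ne_top_of_nonneg (by positivity) hM)
    refine ⟨B ^ (p / 2), ENNReal.rpow_ne_top_of_nonneg (by positivity) hBt,
      fun F G hF hG hFfin hw => ?_⟩
    have htrunc : ∀ N : ℕ, ∫⁻ x, min (F x) N ^ p ∂μ ≤ B ^ (p / 2) * ∫⁻ x, G x ^ p ∂μ := by
      intro N
      set f : X → ℝ≥0∞ := fun x => min (F x) N with hf
      have hfm : Measurable f := hF.min measurable_const
      have hft : ∀ x, f x ≠ ∞ := fun x => ne_top_of_le_ne_top (by simp) (min_le_right _ _)
      have hsplit : ∀ x, f x ^ p = f x ^ (2 : ℝ) * f x ^ (p - 2) := fun x => by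
        rw [← ENNReal.rpow_add_of_nonneg _ _ (by norm_num) hp2'.le]
        congr 1
        ring
      set I := ∫⁻ x, f x ^ p ∂μ with hI
      have hIfin : I ≠ ∞ := by
        refine ne_top_of_le_ne_top (ENNReal.mul_ne_top hFfin
          (ENNReal.rpow_ne_top_of_nonneg hp2'.le (ENNReal.natCast_ne_top N))) ?_
        calc I ≤ ∫⁻ x, F x ^ (2 : ℝ) * (N : ℝ≥0∞) ^ (p - 2) ∂μ := by
              refine lintegral_mono fun x => ?_
              rw [hsplit]
              gcongr
              · exact min_le_left _ _
              · exact min_le_right _ _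
          _ = _ := lintegral_mul_const _ (hF.pow_const _)
      rcases eq_or_ne I 0 with hI0 | hI0
      · rw [hI0]
        exact zero_le
      obtain ⟨u, hu, hfu, hMu, hint⟩ := hmaj (fun x => (f x ^ (p - 2)) ^ r)
        ((hfm.pow_const _).pow_const _)
      have hpow : ∀ x, ((f x ^ (p - 2)) ^ r) ^ e = f x ^ p := fun x => by
        rw [← ENNReal.rpow_mul, ← ENNReal.rpow_mul]
        congr 1
        rw [he']
        field_simp
      simp only [hpow] at hint
      have hwm : Measurable fun x => u x ^ (1 / r) := hu.pow_const _
      have hconj : (p / 2).HolderConjugate (p / (p - 2)) := by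
        rw [Real.holderConjugate_iff]
        refine ⟨by rw [lt_div_iff₀ two_pos]; linarith, by field_simp; ring⟩
      have hstep : I ≤ B * (∫⁻ x, G x ^ p ∂μ) ^ (2 / p) * I ^ ((p - 2) / p) := by
        calc I ≤ ∫⁻ x, F x ^ (2 : ℝ) * u x ^ (1 / r) ∂μ := by
              refine lintegral_mono fun x => ?_
              rw [hsplit]
              gcongr
              · exact min_le_left _ _
              · rw [one_div, ENNReal.le_rpow_inv_iff hr0]
                exact hfu x
          _ ≤ K * L * ∫⁻ x, G x ^ (2 : ℝ) * u x ^ (1 / r) ∂μ := hw _ L hwm (hadm u hu hMu)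
          _ ≤ K * L * ((∫⁻ x, G x ^ p ∂μ) ^ (2 / p) * (∫⁻ x, u x ^ e ∂μ) ^ ((p - 2) / p)) := by
              gcongr
              have := ENNReal.lintegral_mul_le_Lp_mul_Lq μ hconj
                (f := fun x => G x ^ (2 : ℝ)) (g := fun x => u x ^ (1 / r))
                (hG.pow_const _).aemeasurable hwm.aemeasurable
              simp only [Pi.mul_apply, ← ENNReal.rpow_mul, one_div_div] at this
              rwa [show (2 : ℝ) * (p / 2) = p by ring,
                show 1 / r * (p / (p - 2)) = e by rw [he']; ring] at this
          _ ≤ K * L * ((∫⁻ x, G x ^ p ∂μ) ^ (2 / p) * (M * I) ^ ((p - 2) / p)) := by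
              gcongr
          _ = _ := by
              rw [ENNReal.mul_rpow_of_nonneg _ _ (by positivity), hB]
              ring
      have hI2 : I ^ (2 / p) ≤ B * (∫⁻ x, G x ^ p ∂μ) ^ (2 / p) := by
        have hsum : I = I ^ (2 / p) * I ^ ((p - 2) / p) := by
          rw [← ENNReal.rpow_add _ _ hI0 hIfin, show 2 / p + (p - 2) / p = 1 by field_simp; ring,
            ENNReal.rpow_one]
        have hne : I ^ ((p - 2) / p) ≠ 0 := (ENNReal.rpow_pos (pos_iff_ne_zero.2 hI0) hIfin).ne'
        have hnt : I ^ ((p - 2) / p) ≠ ∞ := ENNReal.rpow_ne_top_of_nonneg (by positivity) hIfin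
        refine (ENNReal.mul_le_mul_iff_left hne hnt).1 ?_
        rwa [← hsum]
      calc I = (I ^ (2 / p)) ^ (p / 2) := by
            rw [← ENNReal.rpow_mul, show 2 / p * (p / 2) = 1 by field_simp, ENNReal.rpow_one]
        _ ≤ (B * (∫⁻ x, G x ^ p ∂μ) ^ (2 / p)) ^ (p / 2) := by gcongr
        _ = _ := by
            rw [ENNReal.mul_rpow_of_nonneg _ _ (by positivity), ← ENNReal.rpow_mul,
              show 2 / p * (p / 2) = 1 by field_simp, ENNReal.rpow_one]
    have hlim : Filter.Tendsto (fun N : ℕ => ∫⁻ x, min (F x) N ^ p ∂μ) Filter.atTop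
        (nhds (∫⁻ x, F x ^ p ∂μ)) := by
      refine lintegral_tendsto_of_tendsto_of_monotone
        (fun N => ((hF.min measurable_const).pow_const p).aemeasurable) ?_ ?_
      · refine Filter.Eventually.of_forall fun x N N' hN => ?_
        dsimp only
        gcongr
      · refine Filter.Eventually.of_forall fun x => ?_
        refine (ENNReal.continuous_rpow_const.tendsto _).comp ?_
        simpa using (tendsto_const_nhds (x := F x)).min ENNReal.tendsto_nat_nhds_top
    exact le_of_tendsto' hlim htrunc

end RegularWith

/-! ### Off-diagonal estimates -/

section OffDiagonal

variable {X : Type*} [MetricSpace X] [MeasurableSpace X] [BorelSpace X] {μ : Measure X} {n : ℝ}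
  {c C : ℝ≥0} {V : Type*} [NormedAddCommGroup V]

theorem tendsto_toLp_indicator_ball {f : X → V} (hf : MemLp f 2 μ) (x : X) {t : ℝ} (ht : 0 < t) :
    Filter.Tendsto (fun N : ℕ => (hf.indicator (Metric.isOpen_ball (x := x)
      (ε := 2 ^ (N + 1) * t)).measurableSet).toLp _) Filter.atTop (nhds (hf.toLp f)) := by
  rw [Lp.tendsto_Lp_iff_tendsto_eLpNorm']
  have hg := (hf.toLp f).2
  have hmeas : ∀ N : ℕ, MeasurableSet (Metric.ball x (2 ^ (N + 1) * t)) := fun N =>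
    Metric.isOpen_ball.measurableSet
  set g : X → V := ⇑(hf.toLp f) with hgdef
  have hgm : Measurable fun y => ‖g y‖ₑ := (Lp.stronglyMeasurable _).enorm
  have hgf : g =ᵐ[μ] f := hf.coeFn_toLp
  have hint : ∫⁻ y, ‖g y‖ₑ ^ (2 : ℝ) ∂μ ≠ ∞ := by
    have := lintegral_rpow_enorm_lt_top_of_eLpNorm_lt_top (p := 2) (by simp) (by simp)
      (Lp.eLpNorm_lt_top (hf.toLp f))
    simpa using this.ne
  have hlim : Filter.Tendsto (fun N : ℕ => ∫⁻ y, (Metric.ball x (2 ^ (N + 1) * t))ᶜ.indicator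
      (fun y => ‖g y‖ₑ ^ (2 : ℝ)) y ∂μ) Filter.atTop (nhds (∫⁻ _, 0 ∂μ)) := by
    refine tendsto_lintegral_of_dominated_convergence (fun y => ‖g y‖ₑ ^ (2 : ℝ))
      (fun N => (hgm.pow_const _).indicator (hmeas N).compl)
      (fun N => Filter.Eventually.of_forall fun y => Set.indicator_le_self _ _ y) hint
      (Filter.Eventually.of_forall fun y => ?_)
    refine tendsto_const_nhds.congr' ?_
    have : Filter.Tendsto (fun N : ℕ => (2 : ℝ) ^ (N + 1) * t) Filter.atTop Filter.atTop :=
      ((tendsto_pow_atTop_atTop_of_one_lt one_lt_two).comp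
        (Filter.tendsto_add_atTop_nat 1)).atTop_mul_const ht
    filter_upwards [this.eventually_gt_atTop (dist y x)] with N hN
    rw [Set.indicator_of_notMem]
    simpa using hN
  rw [lintegral_zero] at hlim
  have hlim' := (ENNReal.continuous_rpow_const (y := 1 / 2)).tendsto _ |>.comp hlim
  rw [ENNReal.zero_rpow_of_pos (by norm_num)] at hlim'
  refine hlim'.congr fun N => ?_
  rw [eLpNorm_eq_lintegral_rpow_enorm_toReal (by simp) (by simp), ENNReal.toReal_ofNat,
    Function.comp_apply]
  congr 1
  refine lintegral_congr_ae ?_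
  filter_upwards [(hf.indicator (hmeas N)).coeFn_toLp, hgf] with y hy hy'
  rw [Pi.sub_apply, hy]
  by_cases hyB : y ∈ Metric.ball x (2 ^ (N + 1) * t)
  · have hyB' : y ∉ (Metric.ball x (2 ^ (N + 1) * t))ᶜ := fun h => h hyB
    rw [Set.indicator_of_notMem hyB', Set.indicator_of_mem hyB, ← hy', sub_self]
    simp
  · have hyB' : y ∈ (Metric.ball x (2 ^ (N + 1) * t))ᶜ := hyB
    rw [Set.indicator_of_mem hyB', Set.indicator_of_notMem hyB, zero_sub, enorm_neg]

theorem eLpNorm_indicator_ball_eq_ballAvg (h : RegularWith μ n c C) {p : ℝ≥0∞} (hp0 : p ≠ 0)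
    (hp : p ≠ ∞) (f : X → V) (x : X) {r : ℝ} (hr : 0 < r) :
    eLpNorm ((Metric.ball x r).indicator f) p μ
      = ballVol X n r ^ (1 / p.toReal)
        * ballAvg μ n r (fun y => ‖f y‖ₑ ^ p.toReal) x ^ (1 / p.toReal) := by
  rw [eLpNorm_indicator_eq_eLpNorm_restrict Metric.isOpen_ball.measurableSet,
    eLpNorm_eq_lintegral_rpow_enorm_toReal hp0 hp, ← ENNReal.mul_rpow_of_nonneg _ _ (by positivity),
    ballAvg, ← mul_assoc, ENNReal.mul_inv_cancel (h.ballVol_ne_zero hr) (h.ballVol_ne_top r),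
    one_mul]

variable [NormedSpace ℂ V]

/-- Off-diagonal estimates for the part of `f` in an annulus around a ball. No global
`L^s`-integrability of `f` is needed, because bounded sets have finite measure and `s ≤ 2`. -/
theorem eLpNorm_indicator_ball_annulus_le (h : RegularWith μ n c C) {s q : ℝ≥0∞} (hs : s ≤ 2)
    {U : Set ℂ} {T : U → Lp V 2 μ →L[ℂ] Lp V 2 μ} {γ : ℝ} (hγ : 0 ≤ γ) {K : ℝ≥0}
    (hT : ∀ (z : U) (f : X → V) (hf : MemLp f 2 μ), MemLp f s μ →
      ∀ (E F : Set X) (hE : MeasurableSet E), MeasurableSet F →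
        eLpNorm (F.indicator (T z ((hf.indicator hE).toLp (E.indicator f)))) q μ
        ≤ (K : ℝ≥0∞)
          * min (ENNReal.ofReal ‖(z : ℂ)‖) (Metric.ediam (Set.univ : Set X))
              ^ (n / q.toReal - n / s.toReal)
          * (1 + setEDist E F / ENNReal.ofReal ‖(z : ℂ)‖) ^ (-γ)
          * eLpNorm (E.indicator f) s μ)
    (z : U) (hz : (z : ℂ) ≠ 0) {f : X → V} (hf : MemLp f 2 μ) (x : X) (k : ℕ) {E : Set X}
    (hE : MeasurableSet E) (hEsub : E ⊆ Metric.ball x (2 ^ (k + 1) * ‖(z : ℂ)‖))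
    (hEdisj : k = 0 ∨ Disjoint E (Metric.ball x (2 ^ k * ‖(z : ℂ)‖))) :
    eLpNorm ((Metric.ball x ‖(z : ℂ)‖).indicator
        (T z ((hf.indicator hE).toLp (E.indicator f)))) q μ
      ≤ K * min (ENNReal.ofReal ‖(z : ℂ)‖) (Metric.ediam (Set.univ : Set X))
              ^ (n / q.toReal - n / s.toReal) * (2 ^ k) ^ (-γ)
          * eLpNorm ((Metric.ball x (2 ^ (k + 1) * ‖(z : ℂ)‖)).indicator f) s μ := by
  set t := ‖(z : ℂ)‖ with ht
  have ht0 : 0 < t := norm_pos_iff.2 hz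
  have hf2 : MemLp (E.indicator f) 2 μ := hf.indicator hE
  have hfs : MemLp (E.indicator f) s μ := by
    rw [memLp_indicator_iff_restrict hE]
    have : IsFiniteMeasure (μ.restrict E) := ⟨by
      rw [Measure.restrict_apply_univ]
      exact (measure_mono hEsub).trans_lt (h.measure_ball_lt_top _ _)⟩
    exact hf.restrict E |>.mono_exponent hs
  have key := hT z _ hf2 hfs E (Metric.ball x t) hE Metric.isOpen_ball.measurableSet
  simp only [Set.indicator_indicator, Set.inter_self] at key
  refine key.trans ?_
  have hdist : (2 : ℝ≥0∞) ^ k ≤ 1 + setEDist E (Metric.ball x t) / ENNReal.ofReal t := by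
    rcases hEdisj with rfl | hdisj
    · simp
    have h1 : ENNReal.ofReal (2 ^ k * t - t) ≤ setEDist E (Metric.ball x t) := by
      refine le_iInf₂ fun y hy => le_iInf₂ fun y' hy' => ?_
      rw [edist_dist]
      refine ENNReal.ofReal_le_ofReal ?_
      have hy2 : 2 ^ k * t ≤ dist y x := by
        have := Set.disjoint_left.1 hdisj hy
        simpa using this
      have := dist_triangle y y' x
      rw [Metric.mem_ball] at hy'
      linarith
    have h2 : (2 : ℝ≥0∞) ^ k = 1 + ENNReal.ofReal (2 ^ k * t - t) / ENNReal.ofReal t := by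
      have h2k : (1 : ℝ) ≤ 2 ^ k := one_le_pow₀ (by norm_num)
      rw [← ENNReal.ofReal_div_of_pos ht0, ← ENNReal.ofReal_one,
        ← ENNReal.ofReal_add (by norm_num) (div_nonneg (by nlinarith) ht0.le),
        show (1 : ℝ) + (2 ^ k * t - t) / t = 2 ^ k by field_simp; ring,
        ENNReal.ofReal_pow (by norm_num), ENNReal.ofReal_ofNat]
    rw [h2]
    gcongr
  gcongr ?_ * ?_ * ?_ * ?_
  · exact le_rfl
  · exact le_rfl
  · rw [ENNReal.rpow_neg, ENNReal.rpow_neg]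
    gcongr
  · refine eLpNorm_mono_enorm fun y => ?_
    rw [enorm_indicator_eq_indicator_enorm, enorm_indicator_eq_indicator_enorm]
    exact Set.indicator_le_indicator_of_subset hEsub (by simp) y

/-- Summing the off-diagonal estimates over dyadic annuli. The truncations of `f` to balls converge
to `f` in `L²` only, so the bound passes to the limit along an almost everywhere convergent
subsequence. -/
theorem eLpNorm_indicator_ball_le_tsum (h : RegularWith μ n c C) {s q : ℝ≥0∞} (hs : s ≤ 2)
    (hq : 1 ≤ q) {U : Set ℂ} {T : U → Lp V 2 μ →L[ℂ] Lp V 2 μ} {γ : ℝ} (hγ : 0 ≤ γ)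
    (hT : OffDiagonalEstimates μ n (fun z f => T z f) s q γ) :
    ∃ K : ℝ≥0, ∀ (z : U), (z : ℂ) ≠ 0 → ∀ (f : Lp V 2 μ) (x : X),
      eLpNorm ((Metric.ball x ‖(z : ℂ)‖).indicator (T z f)) q μ
      ≤ ∑' k : ℕ, K * min (ENNReal.ofReal ‖(z : ℂ)‖) (Metric.ediam (Set.univ : Set X))
              ^ (n / q.toReal - n / s.toReal) * (2 ^ k) ^ (-γ)
          * eLpNorm ((Metric.ball x (2 ^ (k + 1) * ‖(z : ℂ)‖)).indicator f) s μ := by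
  obtain ⟨K, hK⟩ := hT
  refine ⟨K, fun z hz f x => ?_⟩
  set t := ‖(z : ℂ)‖ with ht
  have ht0 : 0 < t := norm_pos_iff.2 hz
  set a : ℕ → ℝ≥0∞ := fun k => K * min (ENNReal.ofReal t) (Metric.ediam (Set.univ : Set X))
              ^ (n / q.toReal - n / s.toReal) * (2 ^ k) ^ (-γ)
          * eLpNorm ((Metric.ball x (2 ^ (k + 1) * t)).indicator f) s μ with ha
  have hf : MemLp f 2 μ := Lp.memLp f
  have hB : MeasurableSet (Metric.ball x t) := Metric.isOpen_ball.measurableSet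
  have hBk : ∀ N : ℕ, MeasurableSet (Metric.ball x (2 ^ N * t)) := fun N =>
    Metric.isOpen_ball.measurableSet
  have hmono : ∀ N : ℕ, Metric.ball x (2 ^ N * t) ⊆ Metric.ball x (2 ^ (N + 1) * t) := fun N => by
    refine Metric.ball_subset_ball ?_
    rw [pow_succ]
    nlinarith [pow_pos (two_pos (α := ℝ)) N]
  have hstep : ∀ N : ℕ, eLpNorm ((Metric.ball x t).indicator
      (T z ((hf.indicator (hBk (N + 1))).toLp _))) q μ ≤ ∑ k ∈ Finset.range (N + 1), a k := by
    intro N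
    induction N with
    | zero =>
      rw [Finset.sum_range_one]
      exact eLpNorm_indicator_ball_annulus_le h hs hγ hK z hz hf x 0 (hBk 1) (by simp [ht])
        (Or.inl rfl)
    | succ N ih =>
      set E := Metric.ball x (2 ^ (N + 1 + 1) * t) \ Metric.ball x (2 ^ (N + 1) * t) with hE
      have hEm : MeasurableSet E := (hBk _).diff (hBk _)
      have hadd : (Metric.ball x (2 ^ (N + 1 + 1) * t)).indicator f
          = (Metric.ball x (2 ^ (N + 1) * t)).indicator f + E.indicator f := by
        rw [hE, Set.indicator_sdiff (hmono (N + 1))]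
        abel
      have hsplit : (hf.indicator (hBk (N + 1 + 1))).toLp _
          = (hf.indicator (hBk (N + 1))).toLp _ + (hf.indicator hEm).toLp _ := by
        rw [← MemLp.toLp_add]
        exact MemLp.toLp_congr _ _ (by rw [hadd])
      rw [hsplit, map_add, Finset.sum_range_succ]
      have hae : (Metric.ball x t).indicator (T z ((hf.indicator (hBk (N + 1))).toLp _)
            + T z ((hf.indicator hEm).toLp _) : Lp V 2 μ)
          =ᵐ[μ] (Metric.ball x t).indicator (T z ((hf.indicator (hBk (N + 1))).toLp _))
            + (Metric.ball x t).indicator (T z ((hf.indicator hEm).toLp _)) := by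
        filter_upwards [Lp.coeFn_add (T z ((hf.indicator (hBk (N + 1))).toLp _))
          (T z ((hf.indicator hEm).toLp _))] with y hy
        rw [← Set.indicator_add']
        simp only [Set.indicator, hy]
      rw [eLpNorm_congr_ae hae]
      refine (eLpNorm_add_le ((Lp.aestronglyMeasurable _).indicator hB)
        ((Lp.aestronglyMeasurable _).indicator hB) hq).trans ?_
      gcongr
      exact eLpNorm_indicator_ball_annulus_le h hs hγ hK z hz hf x (N + 1) hEm Set.sdiff_subset
        (Or.inr Set.disjoint_sdiff_left)
  have hlim : Filter.Tendsto (fun N : ℕ => T z ((hf.indicator (hBk (N + 1))).toLp _))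
      Filter.atTop (nhds (T z f)) := by
    have := ((T z).continuous.tendsto _).comp (tendsto_toLp_indicator_ball hf x ht0)
    rwa [Lp.toLp_coeFn] at this
  obtain ⟨ns, -, hns⟩ := (tendstoInMeasure_of_tendsto_Lp hlim).exists_seq_tendsto_ae
  refine Lp.eLpNorm_le_of_ae_tendsto (u := Filter.atTop) (f := fun i : ℕ =>
    (Metric.ball x t).indicator (T z ((hf.indicator (hBk (ns i + 1))).toLp _)))
    (Filter.Eventually.of_forall fun i => (hstep (ns i)).trans (ENNReal.sum_le_tsum _))
    (fun i => (Lp.aestronglyMeasurable _).indicator hB) ?_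
  filter_upwards [hns] with y hy
  by_cases hyB : y ∈ Metric.ball x t
  · simpa only [Set.indicator_of_mem hyB] using hy
  · simp only [Set.indicator_of_notMem hyB, tendsto_const_nhds]

/-- Off-diagonal estimates of order `γ > n / s` control the local `L^q` averages of `T(z) f` at
scale `|z|` by a geometric series of `L^s` averages of `f`. The factor `2 ^ (k n / s)` lost in
passing from norms to averages is absorbed by `2 ^ (-k γ)`. -/
theorem exists_ballAvg_le_tsum_ballAvg (h : RegularWith μ n c C) {s q : ℝ≥0∞} (hs1 : 1 ≤ s)
    (hs : s ≤ 2) (hq1 : 1 ≤ q) (hq : q ≠ ∞) {U : Set ℂ} {T : U → Lp V 2 μ →L[ℂ] Lp V 2 μ} {γ : ℝ}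
    (hγ : n / s.toReal < γ) (hT : OffDiagonalEstimates μ n (fun z f => T z f) s q γ) :
    ∃ K a : ℝ≥0∞, K ≠ ∞ ∧ a < 1 ∧ ∀ (z : U), (z : ℂ) ≠ 0 → ∀ (f : Lp V 2 μ) (x : X),
      ballAvg μ n ‖(z : ℂ)‖ (fun y => ‖T z f y‖ₑ ^ q.toReal) x ^ (1 / q.toReal)
      ≤ K * ∑' k : ℕ, a ^ k * ballAvg μ n (2 ^ (k + 1) * ‖(z : ℂ)‖)
          (fun y => ‖f y‖ₑ ^ s.toReal) x ^ (1 / s.toReal) := by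
  have hn := h.dim_pos
  have hs0 : s ≠ 0 := (one_pos.trans_le hs1).ne'
  have hst : s ≠ ∞ := ne_top_of_le_ne_top (by simp) hs
  have hq0 : q ≠ 0 := (one_pos.trans_le hq1).ne'
  have hsr : 0 < s.toReal := ENNReal.toReal_pos hs0 hst
  have hqr : 0 < q.toReal := ENNReal.toReal_pos hq0 hq
  have hγ0 : 0 ≤ γ := (div_pos hn hsr).le.trans hγ.le
  obtain ⟨K, hK⟩ := eLpNorm_indicator_ball_le_tsum h hs hq1 hγ0 hT
  have h2n : (2 : ℝ≥0∞) ^ (n / s.toReal) ≠ ∞ :=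
    ENNReal.rpow_ne_top_of_nonneg (by positivity) (by simp)
  refine ⟨K * 2 ^ (n / s.toReal), 2 ^ (n / s.toReal - γ), by finiteness,
    ENNReal.rpow_lt_one_of_one_lt_of_neg (by norm_num) (by linarith), fun z hz f x => ?_⟩
  set t := ‖(z : ℂ)‖ with ht
  have ht0 : 0 < t := norm_pos_iff.2 hz
  have key := hK z hz f x
  set m := min (ENNReal.ofReal t) (Metric.ediam (Set.univ : Set X)) with hm
  have hm0 : m ≠ 0 := (lt_min (by simpa using ht0) (pos_iff_ne_zero.2 h.diam_ne_zero)).ne'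
  have hmt : m ≠ ∞ := ne_top_of_le_ne_top ENNReal.ofReal_ne_top (min_le_left _ _)
  have hvol : ballVol X n t = m ^ n := rfl
  have hmq0 : m ^ (n / q.toReal) ≠ 0 := (ENNReal.rpow_pos (pos_iff_ne_zero.2 hm0) hmt).ne'
  have hmqt : m ^ (n / q.toReal) ≠ ∞ := ENNReal.rpow_ne_top_of_nonneg (by positivity) hmt
  rw [eLpNorm_indicator_ball_eq_ballAvg h hq0 hq _ x ht0, hvol, ← ENNReal.rpow_mul,
    mul_one_div] at key
  refine (ENNReal.mul_le_mul_iff_right hmq0 hmqt).1 (key.trans ?_)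
  rw [← mul_assoc, ← ENNReal.tsum_mul_left]
  refine ENNReal.tsum_le_tsum fun k => ?_
  rw [eLpNorm_indicator_ball_eq_ballAvg h hs0 hst _ x (by positivity)]
  set A := ballAvg μ n (2 ^ (k + 1) * t) (fun y => ‖f y‖ₑ ^ s.toReal) x ^ (1 / s.toReal)
  have hvolk : ballVol X n (2 ^ (k + 1) * t) ^ (1 / s.toReal)
      ≤ (2 ^ (n / s.toReal)) ^ (k + 1) * m ^ (n / s.toReal) := by
    calc ballVol X n (2 ^ (k + 1) * t) ^ (1 / s.toReal)
        ≤ (ENNReal.ofReal (2 ^ (k + 1)) ^ n * m ^ n) ^ (1 / s.toReal) := by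
          gcongr
          exact ballVol_mul_le hn.le (one_le_pow₀ (by norm_num)) t
      _ = _ := by
          rw [ENNReal.mul_rpow_of_nonneg _ _ (by positivity), ← ENNReal.rpow_mul,
            ← ENNReal.rpow_mul, mul_one_div, ENNReal.ofReal_pow (by norm_num), ENNReal.ofReal_ofNat,
            ← ENNReal.rpow_natCast, ← ENNReal.rpow_natCast, ← ENNReal.rpow_mul, ← ENNReal.rpow_mul,
            mul_comm (n / s.toReal)]
  calc K * m ^ (n / q.toReal - n / s.toReal) * (2 ^ k) ^ (-γ)
        * (ballVol X n (2 ^ (k + 1) * t) ^ (1 / s.toReal) * A)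
      ≤ K * m ^ (n / q.toReal - n / s.toReal) * (2 ^ k) ^ (-γ)
        * ((2 ^ (n / s.toReal)) ^ (k + 1) * m ^ (n / s.toReal) * A) := by gcongr
    _ = (m ^ (n / q.toReal - n / s.toReal) * m ^ (n / s.toReal)) * K * 2 ^ (n / s.toReal)
        * (((2 ^ (n / s.toReal)) ^ k * (2 ^ k) ^ (-γ)) * A) := by ring
    _ = _ := by
        rw [← ENNReal.rpow_add _ _ hm0 hmt, sub_add_cancel]
        have : ((2 : ℝ≥0∞) ^ (n / s.toReal)) ^ k * (2 ^ k) ^ (-γ)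
            = (2 ^ (n / s.toReal - γ)) ^ k := by
          rw [← ENNReal.rpow_natCast, ← ENNReal.rpow_natCast, ← ENNReal.rpow_natCast,
            ← ENNReal.rpow_mul, ← ENNReal.rpow_mul, ← ENNReal.rpow_mul,
            ← ENNReal.rpow_add _ _ (by simp) (by simp)]
          congr 1
          ring
        rw [this]
        ring

/-- Square function estimates from off-diagonal estimates. -/
theorem squareFunctionEstimates_of_offDiagonalEstimates [SecondCountableTopology X]
    (h : RegularWith μ n c C) {s q p : ℝ≥0∞} (hs1 : 1 ≤ s) (hs2 : s < 2) (hq2 : 2 < q)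
    (hq : q ≠ ∞) (hsp : s < p) (hpq : p < q) {U : Set ℂ} (hU : 0 ∉ U)
    {T : U → Lp V 2 μ →L[ℂ] Lp V 2 μ} {γ : ℝ} (hγ : n / s.toReal < γ)
    (hT : OffDiagonalEstimates μ n (fun z f => T z f) s q γ) :
    SquareFunctionEstimates μ (fun z f => T z f) p := by
  have hst : s ≠ ∞ := ne_top_of_lt hs2
  have hpt : p ≠ ∞ := ne_top_of_lt hpq
  have hp0 : p ≠ 0 := (zero_le.trans_lt hsp).ne'
  have hs1' : 1 ≤ s.toReal := by simpa using ENNReal.toReal_mono hst hs1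
  have hs2' : s.toReal < 2 := by simpa using (ENNReal.toReal_lt_toReal hst (by simp)).2 hs2
  have hq2' : 2 < q.toReal := by simpa using (ENNReal.toReal_lt_toReal (by simp) hq).2 hq2
  have hsp' : s.toReal < p.toReal := (ENNReal.toReal_lt_toReal hst hpt).2 hsp
  have hpq' : p.toReal < q.toReal := (ENNReal.toReal_lt_toReal hpt hq).2 hpq
  have hpr : 0 < p.toReal := by linarith
  obtain ⟨K, a, hK, ha, hloc⟩ := exists_ballAvg_le_tsum_ballAvg h hs1 hs2.le
    ((by norm_num : (1 : ℝ≥0∞) ≤ 2).trans hq2.le) hq hγ hT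
  obtain ⟨K₂, hK₂, hwt⟩ := h.exists_lintegral_sq_mul_weight_le hs1' hq2' hK ha
  obtain ⟨K₃, hK₃, hext⟩ := h.exists_lintegral_rpow_le_of_admissibleWeight hs1' hs2' hq2' hsp' hpq'
    hK₂
  have hKt : K₃ ^ (1 / p.toReal) ≠ ∞ := ENNReal.rpow_ne_top_of_nonneg (by positivity) hK₃
  refine ⟨(K₃ ^ (1 / p.toReal)).toNNReal, fun k z f _ => ?_⟩
  rw [ENNReal.coe_toNNReal hKt]
  have hsq : ∀ g : Fin k → Lp V 2 μ, ∀ x, ‖√(∑ j, ‖g j x‖ ^ 2)‖ₑ ^ (2 : ℝ)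
      = ∑ j, ‖g j x‖ₑ ^ (2 : ℝ) := by
    intro g x
    rw [Real.enorm_of_nonneg (Real.sqrt_nonneg _), ENNReal.ofReal_rpow_of_nonneg
      (Real.sqrt_nonneg _) (by norm_num), Real.rpow_two, Real.sq_sqrt (by positivity),
      ENNReal.ofReal_sum_of_nonneg fun j _ => by positivity]
    refine Finset.sum_congr rfl fun j _ => ?_
    rw [← ofReal_norm, ENNReal.ofReal_rpow_of_nonneg (norm_nonneg _) (by norm_num), Real.rpow_two]
  have hmeas : ∀ g : Fin k → Lp V 2 μ, Measurable fun x => ‖√(∑ j, ‖g j x‖ ^ 2)‖ₑ := by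
    intro g
    refine ((Finset.measurable_fun_sum _ fun j _ => ?_).sqrt).enorm
    exact (Lp.stronglyMeasurable (g j)).norm.measurable.pow_const 2
  have hen : ∀ g : Lp V 2 μ, Measurable fun x => ‖g x‖ₑ := fun g => (Lp.stronglyMeasurable g).enorm
  have hsum : ∀ (g : Fin k → Lp V 2 μ) (w : X → ℝ≥0∞), Measurable w →
      ∫⁻ x, ‖√(∑ j, ‖g j x‖ ^ 2)‖ₑ ^ (2 : ℝ) * w x ∂μ
        = ∑ j, ∫⁻ x, ‖g j x‖ₑ ^ (2 : ℝ) * w x ∂μ := by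
    intro g w hw
    simp only [hsq, Finset.sum_mul]
    exact lintegral_finsetSum _ fun j _ => ((hen _).pow_const _).mul hw
  have hfin : ∫⁻ x, ‖√(∑ j, ‖T (z j) (f j) x‖ ^ 2)‖ₑ ^ (2 : ℝ) ∂μ ≠ ∞ := by
    have := hsum (fun j => T (z j) (f j)) (fun _ => 1) measurable_const
    simp only [mul_one] at this
    rw [this]
    refine ENNReal.sum_ne_top.2 fun j _ => ?_
    have := lintegral_rpow_enorm_lt_top_of_eLpNorm_lt_top (p := 2) (by simp) (by simp)
      (Lp.eLpNorm_lt_top (T (z j) (f j)))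
    simpa using this.ne
  have hmain := hext (fun x => ‖√(∑ j, ‖T (z j) (f j) x‖ ^ 2)‖ₑ)
    (fun x => ‖√(∑ j, ‖f j x‖ ^ 2)‖ₑ) (hmeas fun j => T (z j) (f j)) (hmeas f) hfin
    (fun w L hw hadm => by
      rw [hsum (fun j => T (z j) (f j)) w hw, hsum f w hw, Finset.mul_sum]
      refine Finset.sum_le_sum fun j _ => ?_
      have hz : (z j : ℂ) ≠ 0 := fun e => hU (e ▸ (z j).2)
      exact hwt w L hw hadm ‖(z j : ℂ)‖ _ _ (norm_pos_iff.2 hz) (hen _) (hen _)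
        (hloc (z j) hz (f j)))
  rw [eLpNorm_eq_lintegral_rpow_enorm_toReal hp0 hpt,
    eLpNorm_eq_lintegral_rpow_enorm_toReal hp0 hpt,
    ← ENNReal.mul_rpow_of_nonneg _ _ (by positivity)]
  gcongr

end OffDiagonal

/-! ### Khintchine's inequalities in Hilbert spaces -/

section Khintchine

theorem sum_intUnits {M : Type*} [AddCommMonoid M] (f : ℤˣ → M) : ∑ e, f e = f 1 + f (-1) := by
  rw [show (Finset.univ : Finset ℤˣ) = {1, -1} from rfl, Finset.sum_pair (by decide)]

theorem sum_signs_succ {M : Type*} [AddCommMonoid M] {k : ℕ} (f : (Fin (k + 1) → ℤˣ) → M) :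
    ∑ ε, f ε = ∑ ε : Fin k → ℤˣ, (f (Fin.cons 1 ε) + f (Fin.cons (-1) ε)) := by
  rw [← (Fin.consEquiv fun _ => ℤˣ).sum_comp, Fintype.sum_prod_type, sum_intUnits,
    Finset.sum_add_distrib]
  rfl

/-- Among pairs of nonnegative numbers with given sum, the sum of the powers increases with the
distance of the two numbers. -/
theorem pow_add_pow_le_of_add_eq {P Q A B : ℝ} (hA : 0 ≤ A) (hAP : A ≤ P) (hPB : P ≤ B)
    (hsum : P + Q = A + B) (m : ℕ) : P ^ m + Q ^ m ≤ A ^ m + B ^ m := by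
  rcases (hAP.trans hPB).eq_or_lt with hAB | hAB
  · obtain rfl : P = A := le_antisymm (hPB.trans hAB.ge) hAP
    obtain rfl : Q = B := by linarith
    exact le_rfl
  have hBA : 0 < B - A := by linarith
  set l := (B - P) / (B - A) with hl
  have hl0 : 0 ≤ l := div_nonneg (by linarith) hBA.le
  have hl1 : 0 ≤ 1 - l := by
    rw [hl, sub_nonneg, div_le_one hBA]
    linarith
  have hP : P = l * A + (1 - l) * B := by rw [hl]; field_simp; ring
  have hQ : Q = (1 - l) * A + l * B := by linarith
  have h1 := (convexOn_pow m).2 (x := A) (y := B) hA (hA.trans hAB.le) hl0 hl1 (by ring)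
  have h2 := (convexOn_pow m).2 (x := A) (y := B) hA (hA.trans hAB.le) hl1 hl0 (by ring)
  simp only [smul_eq_mul] at h1 h2
  rw [← hP] at h1
  rw [← hQ] at h2
  linarith

variable {V : Type*} [NormedAddCommGroup V] [InnerProductSpace ℂ V]

/-- The parallelogram law, applied to each term of the power series of `cosh`. -/
theorem cosh_norm_add_add_cosh_norm_sub_le (x v : V) :
    Real.cosh ‖x + v‖ + Real.cosh ‖x - v‖ ≤ 2 * Real.cosh ‖x‖ * Real.cosh ‖v‖ := by
  have hR : 2 * Real.cosh ‖x‖ * Real.cosh ‖v‖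
      = Real.cosh (‖x‖ - ‖v‖) + Real.cosh (‖x‖ + ‖v‖) := by
    rw [Real.cosh_add, Real.cosh_sub]
    ring
  rw [hR]
  refine hasSum_le (fun m => ?_) ((Real.hasSum_cosh _).add (Real.hasSum_cosh _))
    ((Real.hasSum_cosh _).add (Real.hasSum_cosh _))
  rw [← add_div, ← add_div]
  refine div_le_div_of_nonneg_right ?_ (by positivity)
  simp only [pow_mul]
  have hpar := parallelogram_law_with_norm ℂ x v
  refine pow_add_pow_le_of_add_eq (sq_nonneg _) ?_ ?_ (by nlinarith) m
  · rw [sq_le_sq]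
    have := abs_norm_sub_norm_le x (-v)
    rw [norm_neg, sub_neg_eq_add] at this
    exact this.trans (le_abs_self _)
  · gcongr
    exact norm_add_le _ _

theorem sum_signs_cosh_le {k : ℕ} (v : Fin k → V) (x : V) :
    ∑ ε : Fin k → ℤˣ, Real.cosh ‖x + ∑ j, ε j • v j‖
      ≤ 2 ^ k * (Real.cosh ‖x‖ * ∏ j, Real.cosh ‖v j‖) := by
  induction k generalizing x with
  | zero => simp
  | succ k ih =>
    rw [sum_signs_succ, Finset.sum_add_distrib]
    simp only [Fin.sum_univ_succ, Fin.cons_zero, Fin.cons_succ, ← add_assoc, one_smul,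
      Fin.prod_univ_succ]
    have h1 := ih (fun j => v j.succ) (x + v 0)
    have h2 := ih (fun j => v j.succ) (x + (-1 : ℤˣ) • v 0)
    have h3 := cosh_norm_add_add_cosh_norm_sub_le x (v 0)
    have hneg : x + (-1 : ℤˣ) • v 0 = x - v 0 := by simp [Units.smul_def, sub_eq_add_neg]
    rw [hneg] at h2 ⊢
    have hP : 0 ≤ ∏ j : Fin k, Real.cosh ‖v j.succ‖ :=
      Finset.prod_nonneg fun _ _ => (Real.cosh_pos _).le
    calc _ ≤ 2 ^ k * ((Real.cosh ‖x + v 0‖ + Real.cosh ‖x - v 0‖)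
          * ∏ j : Fin k, Real.cosh ‖v j.succ‖) := by linarith
      _ ≤ 2 ^ k * ((2 * Real.cosh ‖x‖ * Real.cosh ‖v 0‖)
          * ∏ j : Fin k, Real.cosh ‖v j.succ‖) := by gcongr
      _ = _ := by ring

theorem sum_signs_sq {k : ℕ} (v : Fin k → V) (x : V) :
    ∑ ε : Fin k → ℤˣ, ‖x + ∑ j, ε j • v j‖ ^ 2 = 2 ^ k * (‖x‖ ^ 2 + ∑ j, ‖v j‖ ^ 2) := by
  induction k generalizing x with
  | zero => simp
  | succ k ih =>
    rw [sum_signs_succ, Finset.sum_add_distrib]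
    simp only [Fin.sum_univ_succ, Fin.cons_zero, Fin.cons_succ, ← add_assoc, one_smul]
    have hneg : x + (-1 : ℤˣ) • v 0 = x - v 0 := by simp [Units.smul_def, sub_eq_add_neg]
    rw [hneg, ih (fun j => v j.succ) (x + v 0), ih (fun j => v j.succ) (x - v 0)]
    have hpar := parallelogram_law_with_norm ℂ x (v 0)
    rw [pow_succ]
    linear_combination (2 : ℝ) ^ k * hpar

theorem exists_rpow_le_mul_cosh {p : ℝ} (hp : 0 < p) :
    ∃ K : ℝ, 0 < K ∧ ∀ t : ℝ, 0 ≤ t → t ^ p ≤ K * Real.cosh t := by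
  obtain ⟨m, hm⟩ := exists_nat_ge p
  refine ⟨1 + 2 * m.factorial, by positivity, fun t ht => ?_⟩
  have hc := Real.one_le_cosh t
  rcases le_or_gt t 1 with h1 | h1
  · have : t ^ p ≤ 1 := Real.rpow_le_one ht h1 hp.le
    have : (0 : ℝ) ≤ 2 * m.factorial * Real.cosh t := by positivity
    linarith
  · have h2 : t ^ p ≤ t ^ m := by
      rw [← Real.rpow_natCast]
      exact Real.rpow_le_rpow_of_exponent_le h1.le hm
    have h3 := Real.pow_div_factorial_le_exp t ht m
    rw [div_le_iff₀ (by positivity)] at h3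
    have h4 : Real.exp t ≤ 2 * Real.cosh t := by
      rw [Real.cosh_eq]
      have := Real.exp_pos (-t)
      linarith
    have h5 : Real.exp t * m.factorial ≤ 2 * Real.cosh t * m.factorial := by gcongr
    nlinarith

/-- The upper Khintchine inequality in a Hilbert space, from the exponential moment bound
`𝔼 cosh ‖∑ ε_j v_j‖ ≤ exp (∑ ‖v_j‖² / 2)` after normalizing to `∑ ‖v_j‖² = 1`. -/
theorem exists_sum_signs_rpow_le (V : Type*) [NormedAddCommGroup V] [InnerProductSpace ℂ V] {p : ℝ}
    (hp : 0 < p) : ∃ K : ℝ, 0 < K ∧ ∀ (k : ℕ) (v : Fin k → V),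
      (2 ^ k : ℝ)⁻¹ * ∑ ε : Fin k → ℤˣ, ‖∑ j, ε j • v j‖ ^ p ≤ K * √(∑ j, ‖v j‖ ^ 2) ^ p := by
  obtain ⟨K, hK, hcosh⟩ := exists_rpow_le_mul_cosh hp
  refine ⟨K * Real.exp (1 / 2), by positivity, fun k v => ?_⟩
  set σ := √(∑ j, ‖v j‖ ^ 2) with hσ
  have hσ2 : σ ^ 2 = ∑ j, ‖v j‖ ^ 2 := Real.sq_sqrt (by positivity)
  have hσ0 : 0 ≤ σ := Real.sqrt_nonneg _
  rcases hσ0.eq_or_lt with h0 | h0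
  · have hv : ∀ j, v j = 0 := by
      intro j
      have : ∑ j, ‖v j‖ ^ 2 = 0 := by rw [← hσ2, ← h0]; norm_num
      have := (Finset.sum_eq_zero_iff_of_nonneg fun j _ => by positivity).1 this j (by simp)
      simpa using this
    simp only [hv, smul_zero, Finset.sum_const_zero, norm_zero, Real.zero_rpow hp.ne', mul_zero]
    positivity
  set u : Fin k → V := fun j => ((σ⁻¹ : ℝ) : ℂ) • v j with hu
  have hnu : ∀ j, ‖u j‖ ^ 2 = σ⁻¹ ^ 2 * ‖v j‖ ^ 2 := fun j => by
    rw [hu, norm_smul, Complex.norm_real, mul_pow, norm_inv, Real.norm_of_nonneg h0.le]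
  have hcomb : ∀ ε : Fin k → ℤˣ, ‖∑ j, ε j • v j‖ = σ * ‖∑ j, ε j • u j‖ := by
    intro ε
    have : ∑ j, ε j • u j = ((σ⁻¹ : ℝ) : ℂ) • ∑ j, ε j • v j := by
      rw [Finset.smul_sum]
      exact Finset.sum_congr rfl fun j _ => smul_comm _ _ _
    rw [this, norm_smul, Complex.norm_real, norm_inv, Real.norm_of_nonneg h0.le,
      mul_inv_cancel_left₀ h0.ne']
  have hsum := sum_signs_cosh_le u 0
  simp only [zero_add, norm_zero, Real.cosh_zero, one_mul] at hsum
  have hprod : ∏ j, Real.cosh ‖u j‖ ≤ Real.exp (1 / 2) := by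
    calc ∏ j, Real.cosh ‖u j‖ ≤ ∏ j, Real.exp (‖u j‖ ^ 2 / 2) :=
          Finset.prod_le_prod (fun _ _ => (Real.cosh_pos _).le)
            fun j _ => Real.cosh_le_exp_half_sq _
      _ = Real.exp (1 / 2) := by
          rw [← Real.exp_sum, ← Finset.sum_div]
          simp only [hnu]
          rw [← Finset.mul_sum, ← hσ2, ← mul_pow, inv_mul_cancel₀ h0.ne', one_pow]
  calc (2 ^ k : ℝ)⁻¹ * ∑ ε : Fin k → ℤˣ, ‖∑ j, ε j • v j‖ ^ p
      = σ ^ p * ((2 ^ k : ℝ)⁻¹ * ∑ ε : Fin k → ℤˣ, ‖∑ j, ε j • u j‖ ^ p) := by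
        simp only [hcomb, Real.mul_rpow h0.le (norm_nonneg _)]
        rw [← Finset.mul_sum]
        ring
    _ ≤ σ ^ p * ((2 ^ k : ℝ)⁻¹ * ∑ ε : Fin k → ℤˣ, K * Real.cosh ‖∑ j, ε j • u j‖) := by
        gcongr with ε
        exact hcosh _ (norm_nonneg _)
    _ = σ ^ p * (K * ((2 ^ k : ℝ)⁻¹ * ∑ ε : Fin k → ℤˣ, Real.cosh ‖∑ j, ε j • u j‖)) := by
        rw [← Finset.mul_sum]
        ring
    _ ≤ σ ^ p * (K * ((2 ^ k : ℝ)⁻¹ * (2 ^ k * Real.exp (1 / 2)))) := by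
        gcongr
        exact hsum.trans (by gcongr)
    _ = _ := by
        rw [inv_mul_cancel_left₀ (by positivity)]
        ring

/-- The lower Khintchine inequality for the first moment in a Hilbert space: the second moment is
known exactly, and it splits into a part controlled by the first moment and a part controlled by the
fourth. -/
theorem exists_sqrt_sum_le_sum_signs (V : Type*) [NormedAddCommGroup V] [InnerProductSpace ℂ V] :
    ∃ K : ℝ, 0 < K ∧ ∀ (k : ℕ) (v : Fin k → V),
      √(∑ j, ‖v j‖ ^ 2) ≤ K * ((2 ^ k : ℝ)⁻¹ * ∑ ε : Fin k → ℤˣ, ‖∑ j, ε j • v j‖) := by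
  obtain ⟨K, hK, h4⟩ := exists_sum_signs_rpow_le V (p := 4) (by norm_num)
  -- `a` times the standard deviation is the threshold of the splitting; this choice makes the part
  -- above it at most half of the second moment
  set a := √(2 * K) with ha
  have ha0 : 0 < a := Real.sqrt_pos.2 (by positivity)
  have ha2 : a ^ 2 = 2 * K := Real.sq_sqrt (by positivity)
  refine ⟨2 * a, by positivity, fun k v => ?_⟩
  have h4' := h4 k v
  have h2 := sum_signs_sq v 0
  set σ := √(∑ j, ‖v j‖ ^ 2) with hσ
  have hσ2 : σ ^ 2 = ∑ j, ‖v j‖ ^ 2 := Real.sq_sqrt (by positivity)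
  have hN : (0 : ℝ) < 2 ^ k := by positivity
  have hσ0 : 0 ≤ σ := Real.sqrt_nonneg _
  rcases hσ0.eq_or_lt with h0 | h0
  · rw [← h0]
    positivity
  simp only [zero_add, norm_zero, ne_eq, OfNat.ofNat_ne_zero, not_false_eq_true, zero_pow,
    ← hσ2] at h2
  simp only [show (4 : ℝ) = ((4 : ℕ) : ℝ) by norm_num, Real.rpow_natCast] at h4'
  set E1 := (2 ^ k : ℝ)⁻¹ * ∑ ε : Fin k → ℤˣ, ‖∑ j, ε j • v j‖ with hE1
  set E4 := (2 ^ k : ℝ)⁻¹ * ∑ ε : Fin k → ℤˣ, ‖∑ j, ε j • v j‖ ^ 4 with hE4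
  have hpt : ∀ t : ℝ, 0 ≤ t → t ^ 2 ≤ a * σ * t + (a ^ 2 * σ ^ 2)⁻¹ * t ^ 4 := by
    intro t ht
    have haσ : 0 < a * σ := by positivity
    rcases le_or_gt t (a * σ) with hle | hgt
    · have : 0 ≤ (a ^ 2 * σ ^ 2)⁻¹ * t ^ 4 := by positivity
      nlinarith
    · have h1 : t ^ 2 ≤ (a ^ 2 * σ ^ 2)⁻¹ * t ^ 4 := by
        rw [inv_mul_eq_div, le_div_iff₀ (by positivity), show t ^ 4 = t ^ 2 * t ^ 2 by ring,
          ← mul_pow]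
        gcongr
      have : 0 ≤ a * σ * t := by positivity
      linarith
  have hsum : σ ^ 2 ≤ a * σ * E1 + (a ^ 2 * σ ^ 2)⁻¹ * E4 := by
    have : (2 ^ k : ℝ)⁻¹ * ∑ ε : Fin k → ℤˣ, ‖∑ j, ε j • v j‖ ^ 2
        ≤ (2 ^ k : ℝ)⁻¹ * ∑ ε : Fin k → ℤˣ, (a * σ * ‖∑ j, ε j • v j‖
          + (a ^ 2 * σ ^ 2)⁻¹ * ‖∑ j, ε j • v j‖ ^ 4) := by
      gcongr with ε
      exact hpt _ (norm_nonneg _)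
    rw [h2, inv_mul_cancel_left₀ hN.ne', Finset.sum_add_distrib, ← Finset.mul_sum,
      ← Finset.mul_sum] at this
    refine this.trans_eq ?_
    rw [hE1, hE4]
    ring
  have hE4' : (a ^ 2 * σ ^ 2)⁻¹ * E4 ≤ σ ^ 2 / 2 := by
    rw [inv_mul_eq_div, div_le_iff₀ (by positivity), ha2]
    refine h4'.trans_eq ?_
    ring
  have : σ * σ ≤ σ * (2 * a * E1) := by nlinarith
  exact le_of_mul_le_mul_left this h0

end Khintchine

/-! ### Random sums, extension and `R`-boundedness -/

section RandomSums

variable {X : Type*} [MeasurableSpace X] {μ : Measure X} {V : Type*} [NormedAddCommGroup V]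
  {p : ℝ≥0∞}

theorem coeFn_sum_signs_smul {k : ℕ} (ε : Fin k → ℤˣ) (f : Fin k → Lp V p μ) :
    ⇑(∑ j, ε j • f j) =ᵐ[μ] fun x => ∑ j, ε j • f j x := by
  have h1 : ∀ j, ⇑(ε j • f j) =ᵐ[μ] fun x => ε j • f j x := by
    intro j
    rcases Int.units_eq_one_or (ε j) with h | h
    · simp [h]
    · rw [h]
      have h2 : ((-1 : ℤˣ) • f j) = -f j := by simp [Units.smul_def]
      rw [h2]
      filter_upwards [Lp.coeFn_neg (f j)] with x hx
      rw [hx]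
      simp [Units.smul_def]
  have h3 : ∀ s : Finset (Fin k), ⇑(∑ j ∈ s, ε j • f j) =ᵐ[μ] fun x => ∑ j ∈ s, ε j • f j x := by
    classical
    intro s
    induction s using Finset.induction_on with
    | empty =>
      simp only [Finset.sum_empty]
      exact Lp.coeFn_zero _ _ _
    | insert a s ha ih =>
      simp only [Finset.sum_insert ha]
      filter_upwards [Lp.coeFn_add (ε a • f a) (∑ j ∈ s, ε j • f j), ih, h1 a] with x hx hx1 hx2
      rw [hx, Pi.add_apply, hx1, hx2]
  exact h3 Finset.univ

theorem ofReal_rademacherAverage {k : ℕ} [Fact (1 ≤ p)] (f : Fin k → Lp V p μ) :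
    ENNReal.ofReal (rademacherAverage f)
      = (2 ^ k)⁻¹ * ∑ ε : Fin k → ℤˣ, eLpNorm (fun x => ∑ j, ε j • f j x) p μ := by
  rw [rademacherAverage, ENNReal.ofReal_mul (by positivity), ENNReal.ofReal_inv_of_pos
    (by positivity), ENNReal.ofReal_pow (by norm_num), ENNReal.ofReal_ofNat,
    ENNReal.ofReal_sum_of_nonneg fun _ _ => norm_nonneg _]
  congr 2
  ext ε
  rw [ofReal_norm, Lp.enorm_def]
  exact eLpNorm_congr_ae (coeFn_sum_signs_smul ε f)

variable [InnerProductSpace ℂ V]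

/-- Random sums in `L^p` are dominated by square functions. -/
theorem exists_rademacherAverage_le_eLpNorm_sqrt [Fact (1 ≤ p)] (hp : p ≠ ∞) :
    ∃ K : ℝ≥0, ∀ (k : ℕ) (f : Fin k → Lp V p μ), ENNReal.ofReal (rademacherAverage f)
      ≤ K * eLpNorm (fun x => √(∑ j, ‖f j x‖ ^ 2)) p μ := by
  have h1 : 1 ≤ p := Fact.out
  have hp0 : p ≠ 0 := (one_pos.trans_le h1).ne'
  have hr : 1 ≤ p.toReal := by simpa using ENNReal.toReal_mono hp h1
  have hr0 : 0 < p.toReal := by linarith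
  obtain ⟨K, hK, hKh⟩ := exists_sum_signs_rpow_le V hr0
  have hKt : ENNReal.ofReal K ^ (1 / p.toReal) ≠ ∞ :=
    ENNReal.rpow_ne_top_of_nonneg (by positivity) (by simp)
  refine ⟨(ENNReal.ofReal K ^ (1 / p.toReal)).toNNReal, fun k f => ?_⟩
  rw [ENNReal.coe_toNNReal hKt, ofReal_rademacherAverage]
  set S : (Fin k → ℤˣ) → X → V := fun ε x => ∑ j, ε j • f j x with hS
  have hSm : ∀ ε, AEMeasurable (fun x => ‖S ε x‖ₑ ^ p.toReal) μ := fun ε =>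
    (((Lp.aestronglyMeasurable _).congr (coeFn_sum_signs_smul ε f)).enorm).pow_const _
  have hcard : ∑ _ε : Fin k → ℤˣ, ((2 : ℝ≥0∞) ^ k)⁻¹ = 1 := by
    simp only [Finset.sum_const, Finset.card_univ, Fintype.card_pi, Fintype.card_units_int,
      Finset.prod_const, Fintype.card_fin, nsmul_eq_mul]
    push_cast
    exact ENNReal.mul_inv_cancel (by simp) (by finiteness)
  have hpt : ∀ x, (2 ^ k)⁻¹ * ∑ ε, ‖S ε x‖ₑ ^ p.toReal
      ≤ ENNReal.ofReal K * ‖√(∑ j, ‖f j x‖ ^ 2)‖ₑ ^ p.toReal := by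
    intro x
    have := ENNReal.ofReal_le_ofReal (hKh k fun j => f j x)
    rw [ENNReal.ofReal_mul (by positivity), ENNReal.ofReal_mul hK.le, ENNReal.ofReal_inv_of_pos
      (by positivity), ENNReal.ofReal_pow (by norm_num), ENNReal.ofReal_ofNat,
      ENNReal.ofReal_sum_of_nonneg fun _ _ => by positivity,
      ← ENNReal.ofReal_rpow_of_nonneg (Real.sqrt_nonneg _) hr0.le,
      ← Real.enorm_of_nonneg (Real.sqrt_nonneg _)] at this
    refine le_trans (le_of_eq ?_) this
    congr 2
    ext ε
    rw [← ENNReal.ofReal_rpow_of_nonneg (norm_nonneg _) hr0.le, ofReal_norm]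
  have hpow : ((2 ^ k)⁻¹ * ∑ ε, eLpNorm (S ε) p μ) ^ p.toReal
      ≤ ENNReal.ofReal K * ∫⁻ x, ‖√(∑ j, ‖f j x‖ ^ 2)‖ₑ ^ p.toReal ∂μ := by
    calc ((2 ^ k)⁻¹ * ∑ ε, eLpNorm (S ε) p μ) ^ p.toReal
        ≤ ∑ ε, (2 ^ k)⁻¹ * eLpNorm (S ε) p μ ^ p.toReal := by
          rw [Finset.mul_sum]
          exact ENNReal.rpow_arith_mean_le_arith_mean_rpow _ _ _ hcard hr
      _ = (2 ^ k)⁻¹ * ∑ ε, ∫⁻ x, ‖S ε x‖ₑ ^ p.toReal ∂μ := by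
          rw [← Finset.mul_sum]
          congr 2
          ext ε
          rw [eLpNorm_eq_lintegral_rpow_enorm_toReal hp0 hp, ← ENNReal.rpow_mul,
            one_div_mul_cancel hr0.ne', ENNReal.rpow_one]
      _ = ∫⁻ x, (2 ^ k)⁻¹ * ∑ ε, ‖S ε x‖ₑ ^ p.toReal ∂μ := by
          rw [← lintegral_finsetSum' _ fun ε _ => hSm ε, lintegral_const_mul' _ _ (by simp)]
      _ ≤ ∫⁻ x, ENNReal.ofReal K * ‖√(∑ j, ‖f j x‖ ^ 2)‖ₑ ^ p.toReal ∂μ := lintegral_mono hpt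
      _ = _ := lintegral_const_mul' _ _ (by simp)
  rw [eLpNorm_eq_lintegral_rpow_enorm_toReal hp0 hp (f := fun x => √(∑ j, ‖f j x‖ ^ 2)),
    ← ENNReal.mul_rpow_of_nonneg _ _ (by positivity), one_div, ENNReal.le_rpow_inv_iff hr0]
  exact hpow

/-- Square functions in `L^p` are dominated by random sums. -/
theorem exists_eLpNorm_sqrt_le_rademacherAverage [Fact (1 ≤ p)] :
    ∃ K : ℝ≥0, ∀ (k : ℕ) (f : Fin k → Lp V p μ),
      eLpNorm (fun x => √(∑ j, ‖f j x‖ ^ 2)) p μ ≤ K * ENNReal.ofReal (rademacherAverage f) := by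
  have h1 : 1 ≤ p := Fact.out
  obtain ⟨K, hK, hKh⟩ := exists_sqrt_sum_le_sum_signs V
  refine ⟨K.toNNReal, fun k f => ?_⟩
  rw [ofReal_rademacherAverage]
  set S : (Fin k → ℤˣ) → X → V := fun ε x => ∑ j, ε j • f j x with hS
  have hSm : ∀ ε, AEStronglyMeasurable (fun x => ‖S ε x‖) μ := fun ε =>
    ((Lp.aestronglyMeasurable _).congr (coeFn_sum_signs_smul ε f)).norm
  calc eLpNorm (fun x => √(∑ j, ‖f j x‖ ^ 2)) p μ
      ≤ eLpNorm ((K * (2 ^ k : ℝ)⁻¹) • ∑ ε, fun x => ‖S ε x‖) p μ := by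
        refine eLpNorm_mono_real fun x => ?_
        rw [Real.norm_of_nonneg (Real.sqrt_nonneg _), Pi.smul_apply, Finset.sum_apply, smul_eq_mul,
          mul_assoc]
        exact hKh k fun j => f j x
    _ = ‖K * (2 ^ k : ℝ)⁻¹‖ₑ * eLpNorm (∑ ε, fun x => ‖S ε x‖) p μ := eLpNorm_const_smul _ _ _ _
    _ ≤ ‖K * (2 ^ k : ℝ)⁻¹‖ₑ * ∑ ε, eLpNorm (S ε) p μ := by
        gcongr
        refine (eLpNorm_sum_le (fun ε _ => hSm ε) h1).trans_eq ?_
        simp only [eLpNorm_norm]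
    _ = _ := by
        rw [Real.enorm_of_nonneg (by positivity), ENNReal.ofReal_mul hK.le,
          ENNReal.ofReal_inv_of_pos (by positivity), ENNReal.ofReal_pow (by norm_num),
          ENNReal.ofReal_ofNat, mul_assoc]
        rfl

end RandomSums

section Extension

variable {X : Type*} [MeasurableSpace X] {μ : Measure X} {V : Type*} [NormedAddCommGroup V]
  [InnerProductSpace ℂ V] {p : ℝ≥0∞}

/-- The subspace `L^p ∩ L²` of `L²`. -/
def l2InterLp (μ : Measure X) (V : Type*) [NormedAddCommGroup V] [InnerProductSpace ℂ V]
    (p : ℝ≥0∞) : Submodule ℂ (Lp V 2 μ) where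
  carrier := {f | MemLp f p μ}
  zero_mem' := (memLp_congr_ae (Lp.coeFn_zero V 2 μ)).2 MemLp.zero
  add_mem' {f g} hf hg := (memLp_congr_ae (Lp.coeFn_add f g)).2 (hf.add hg)
  smul_mem' a f hf := (memLp_congr_ae (Lp.coeFn_smul a f)).2 (hf.const_smul a)

/-- A linear map of `L²` that maps `L^p ∩ L²` to `L^p` restricts to a linear map from `L^p ∩ L²`
to `L^p`. -/
theorem exists_linearMap_coeFn_ae_eq [Fact (1 ≤ p)] (A : Lp V 2 μ →L[ℂ] Lp V 2 μ)
    (hA : ∀ f : Lp V 2 μ, MemLp f p μ → MemLp (A f) p μ) :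
    ∃ B : l2InterLp μ V p →ₗ[ℂ] Lp V p μ, ∀ f : l2InterLp μ V p, B f =ᵐ[μ] A f := by
  refine ⟨{ toFun := fun f => (hA f f.2).toLp _, map_add' := fun f g => ?_,
            map_smul' := fun a f => ?_ }, fun f => (hA f f.2).coeFn_toLp⟩
  · rw [← MemLp.toLp_add]
    refine MemLp.toLp_congr _ _ ?_
    rw [Submodule.coe_add, map_add]
    exact Lp.coeFn_add _ _
  · rw [RingHom.id_apply, ← MemLp.toLp_const_smul]
    refine MemLp.toLp_congr _ _ ?_
    rw [Submodule.coe_smul, map_smul]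
    exact Lp.coeFn_smul _ _

/-- `L^p ∩ L²` is dense in `L^p`, because it contains the integrable simple functions. -/
theorem denseRange_of_coeFn_ae_eq [Fact (1 ≤ p)] (hp : p ≠ ∞) {e : l2InterLp μ V p →ₗ[ℂ] Lp V p μ}
    (he : ∀ f : l2InterLp μ V p, e f =ᵐ[μ] (f : Lp V 2 μ)) : DenseRange e := by
  have hp0 : p ≠ 0 := (one_pos.trans_le (Fact.out : 1 ≤ p)).ne'
  refine Dense.mono ?_ (Lp.simpleFunc.denseRange (E := V) (μ := μ) hp)
  rintro _ ⟨g, rfl⟩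
  have hgp := Lp.simpleFunc.memLp g
  have hg2 : MemLp (Lp.simpleFunc.toSimpleFunc g) 2 μ :=
    (SimpleFunc.memLp_iff_finMeasSupp (by simp) (by simp)).2
      ((SimpleFunc.memLp_iff_finMeasSupp hp0 hp).1 hgp)
  refine ⟨⟨hg2.toLp _, (memLp_congr_ae hg2.coeFn_toLp).2 hgp⟩, Lp.ext ?_⟩
  exact (he _).trans (hg2.coeFn_toLp.trans (Lp.simpleFunc.toSimpleFunc_eq_toFun g))

theorem continuous_rademacherAverage {B : Type*} [NormedAddCommGroup B] {k : ℕ} :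
    Continuous (rademacherAverage : (Fin k → B) → ℝ) := by
  unfold rademacherAverage
  simp only [Units.smul_def]
  fun_prop

/-- Square function estimates on `L^p ∩ L²` give a uniformly bounded and `R`-bounded extension
to `L^p`: by Khintchine's inequalities random sums and square functions are comparable. -/
theorem SquareFunctionEstimates.exists_isRBounded_extension [CompleteSpace V] [Fact (1 ≤ p)]
    (hp : p ≠ ∞) {ι : Type*} {T : ι → Lp V 2 μ →L[ℂ] Lp V 2 μ}
    (hT : SquareFunctionEstimates μ (fun z f => T z f) p) :
    ∃ S : ι → Lp V p μ →L[ℂ] Lp V p μ,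
      (∀ (z : ι) (f : X → V) (h2 : MemLp f 2 μ) (hp : MemLp f p μ),
        S z (hp.toLp f) =ᵐ[μ] T z (h2.toLp f)) ∧
      (∃ C : ℝ, ∀ z : ι, ‖S z‖ ≤ C) ∧ IsRBounded S := by
  obtain ⟨C, hC⟩ := hT
  have hbound : ∀ (z : ι) (f : Lp V 2 μ), MemLp f p μ →
      eLpNorm (T z f) p μ ≤ C * eLpNorm f p μ := by
    intro z f hf
    have := hC 1 (fun _ => z) (fun _ => f) (fun _ => hf)
    simpa only [Fin.sum_univ_one, Real.sqrt_sq (norm_nonneg _), eLpNorm_norm] using this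
  have hmem : ∀ (z : ι) (f : Lp V 2 μ), MemLp f p μ → MemLp (T z f) p μ := fun z f hf =>
    ⟨Lp.aestronglyMeasurable _, (hbound z f hf).trans_lt
      (ENNReal.mul_lt_top ENNReal.coe_lt_top hf.2)⟩
  obtain ⟨e, he⟩ := exists_linearMap_coeFn_ae_eq (μ := μ) (V := V) (p := p)
    (ContinuousLinearMap.id ℂ _) fun _ hf => hf
  simp only [ContinuousLinearMap.id_apply] at he
  have hdense : DenseRange e := denseRange_of_coeFn_ae_eq hp he
  choose A hA using fun z => exists_linearMap_coeFn_ae_eq (T z) (hmem z)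
  have hAe : ∀ z f, ‖A z f‖ ≤ C * ‖e f‖ := by
    intro z f
    have hf : MemLp (f : Lp V 2 μ) p μ := f.2
    have hfin : eLpNorm (f : Lp V 2 μ) p μ ≠ ∞ := hf.2.ne
    rw [Lp.norm_def, Lp.norm_def, eLpNorm_congr_ae (hA z f), eLpNorm_congr_ae (he f),
      ← ENNReal.coe_toReal, ← ENNReal.toReal_mul]
    exact ENNReal.toReal_mono (by finiteness) (hbound z f hf)
  have hSe : ∀ z f, (A z).extendOfNorm e (e f) = A z f := fun z f =>
    LinearMap.extendOfNorm_eq hdense ⟨C, hAe z⟩ f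
  refine ⟨fun z => (A z).extendOfNorm e, fun z f h2 hfp => ?_,
    ⟨C, fun z => LinearMap.opNorm_extendOfNorm_le hdense C.2 (hAe z)⟩, ?_⟩
  · set g : l2InterLp μ V p := ⟨h2.toLp f, (memLp_congr_ae h2.coeFn_toLp).2 hfp⟩ with hg
    have heg : e g = hfp.toLp f :=
      Lp.ext ((he g).trans (h2.coeFn_toLp.trans hfp.coeFn_toLp.symm))
    rw [← heg, hSe]
    exact hA z g
  · obtain ⟨K₁, hK₁⟩ := exists_rademacherAverage_le_eLpNorm_sqrt (μ := μ) (V := V) hp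
    obtain ⟨K₂, hK₂⟩ := exists_eLpNorm_sqrt_le_rademacherAverage (μ := μ) (V := V) (p := p)
    refine ⟨K₁ * C * K₂, fun k z x => ?_⟩
    refine (DenseRange.piMap fun _ : Fin k => hdense).induction_on
      (p := fun x : Fin k → Lp V p μ =>
        rademacherAverage (fun j => (A (z j)).extendOfNorm e (x j))
          ≤ K₁ * C * K₂ * rademacherAverage x) x ?_ fun g => ?_
    · refine isClosed_le (continuous_rademacherAverage.comp ?_)
        (continuous_const.mul continuous_rademacherAverage)
      fun_prop
    · have hx : ∀ j, Pi.map (fun _ => e) g j = e (g j) := fun j => rfl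
      simp only [hx, hSe]
      have hnn : 0 ≤ rademacherAverage (Pi.map (fun _ : Fin k => e) g) := by
        unfold rademacherAverage
        positivity
      rw [← ENNReal.ofReal_le_ofReal_iff (by positivity)]
      have hsqA : (fun x => √(∑ j, ‖A (z j) (g j) x‖ ^ 2))
          =ᵐ[μ] fun x => √(∑ j, ‖T (z j) (g j) x‖ ^ 2) := by
        have : ∀ᵐ x ∂μ, ∀ j, A (z j) (g j) x = T (z j) (g j) x :=
          ae_all_iff.2 fun j => hA (z j) (g j)
        filter_upwards [this] with x hx
        simp only [hx]
      have hsqe : (fun x => √(∑ j, ‖e (g j) x‖ ^ 2))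
          =ᵐ[μ] fun x => √(∑ j, ‖(g j : Lp V 2 μ) x‖ ^ 2) := by
        have : ∀ᵐ x ∂μ, ∀ j, e (g j) x = (g j : Lp V 2 μ) x :=
          ae_all_iff.2 fun j => he (g j)
        filter_upwards [this] with x hx
        simp only [hx]
      calc ENNReal.ofReal (rademacherAverage fun j => A (z j) (g j))
          ≤ K₁ * eLpNorm (fun x => √(∑ j, ‖A (z j) (g j) x‖ ^ 2)) p μ := hK₁ k _
        _ = K₁ * eLpNorm (fun x => √(∑ j, ‖T (z j) (g j) x‖ ^ 2)) p μ := by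
            rw [eLpNorm_congr_ae hsqA]
        _ ≤ K₁ * (C * eLpNorm (fun x => √(∑ j, ‖(g j : Lp V 2 μ) x‖ ^ 2)) p μ) := by
            gcongr
            exact hC k z (fun j => g j) fun j => (g j).2
        _ = K₁ * (C * eLpNorm (fun x => √(∑ j, ‖e (g j) x‖ ^ 2)) p μ) := by
            rw [eLpNorm_congr_ae hsqe]
        _ ≤ K₁ * (C * (K₂ * ENNReal.ofReal (rademacherAverage fun j => e (g j)))) := by
            gcongr
            exact hK₂ k _
        _ = _ := by
            rw [ENNReal.ofReal_mul (by positivity), ENNReal.ofReal_mul (by positivity),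
              ENNReal.ofReal_mul (by positivity)]
            simp only [ENNReal.ofReal_coe_nnreal, mul_assoc]
            rfl

end Extension

theorem proposition5p6
    {X : Type*} [MetricSpace X] [MeasurableSpace X] [BorelSpace X] (μ : Measure X)
    {V : Type*} [NormedAddCommGroup V] [InnerProductSpace ℂ V] [FiniteDimensional ℂ V]
    (n : ℝ) (hn : 0 < n) (hX : IsRegularSpace μ n)
    (s q p : ℝ≥0∞) [Fact (1 ≤ p)] (hs1 : 1 ≤ s) (hs2 : s < 2) (hq2 : 2 < q) (hq : q < ∞)
    (hsp : s < p) (hpq : p < q)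
    (U : Set ℂ) (hU : 0 ∉ U) (T : U → Lp V 2 μ →L[ℂ] Lp V 2 μ)
    (γ : ℝ) (hγ : n / s.toReal < γ)
    (hT : OffDiagonalEstimates μ n (fun z f => T z f) s q γ) :
    SquareFunctionEstimates μ (fun z f => T z f) p ∧
    ∃ S : U → Lp V p μ →L[ℂ] Lp V p μ,
      (∀ (z : U) (f : X → V) (h2 : MemLp f 2 μ) (hp : MemLp f p μ),
        S z (hp.toLp f) =ᵐ[μ] T z (h2.toLp f)) ∧
      (∃ C : ℝ, ∀ z : U, ‖S z‖ ≤ C) ∧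
      IsRBounded S := by
  have hsq : SquareFunctionEstimates μ (fun z f => T z f) p := by
    obtain ⟨c, C, hc, hball⟩ := hX
    rcases eq_or_ne (Metric.ediam (Set.univ : Set X)) 0 with hdiam | hdiam
    · -- on a space of diameter zero the regularity condition forces `μ = 0`
      have hμ : μ = 0 := by
        rcases isEmpty_or_nonempty X with hX | ⟨⟨x⟩⟩
        · exact μ.eq_zero_of_isEmpty
        · rw [← Measure.measure_univ_eq_zero, ← Metric.iUnion_ball_nat_succ x,
            measure_iUnion_null_iff]
          intro k
          have := (hball x (k + 1) (by positivity)).2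
          simpa [hdiam, hn, hn.ne'] using this
      refine ⟨0, fun k z f _ => ?_⟩
      subst hμ
      simp
    · have h : RegularWith μ n c C := ⟨hn, hc, hdiam, fun x r hr => (hball x r hr).1,
        fun x r hr => (hball x r hr).2⟩
      have := h.secondCountableTopology
      exact squareFunctionEstimates_of_offDiagonalEstimates h hs1 hs2 hq2 hq.ne hsp hpq hU hγ hT
  have : CompleteSpace V := FiniteDimensional.complete ℂ V
  exact ⟨hsq, hsq.exists_isRBounded_extension (ne_top_of_lt hpq)⟩
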